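/- Let $p$ be a prime and let $S_p=\{(y_0,y_1,\dots)\in\mathbb T^{\infty}: y_j=y_{j+1}^p \text{ for all } j\ge 0\}$ be the $p$-adic solenoid, a compact abelian group (written additively, with neutral element $e=(1,1,\dots)$) with the topology induced from the product of circles. Its characters are $\chi_{d,\ell}(y)=y_d^{\ell}$ ($d\in\mathbb Z_{\ge 0}$, $\ell\in\mathbb Z$). Let $\arg:\mathbb T\to[-\pi,\pi)$ be given by $\arg(e^{ix})=x$ for $-\pi\le x<\pi$, and let $h:\mathbb R\to\mathbb R$ be given by $h(x)=-x-\pi$ for $-\pi\le x<-\pi/2$, $h(x)=x$ for $-\pi/2\le x<\pi/2$, $h(x)=-x+\pi$ for $\pi/2\le x<\pi$, and $h(x)=0$ otherwise. For $b\ge 0$ let $\psi_b(\chi_{d,\ell})=b\ell^2/p^{2d}$, and let $g_{S_p}(y,\chi_{d,\ell})=\ell\,h(\arg y_0)/p^d$. A (possibly infinite) Borel measure $\eta$ on $S_p$ is a Lévy measure if $\eta(\{e\})=0$, $\eta(S_p\setminus U)<\infty$ for every Borel neighbourhood $U$ of $e$, and $\int(1-\operatorname{Re}\chi)\,d\eta<\infty$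 for every character $\chi$. The measures $\gamma_{\psi_b}$ and $\pi_{\eta,g_{S_p}}$ are the probability measures on $S_p$ with Fourier transforms $\widehat\gamma_{\psi_b}(\chi)=e^{-\psi_b(\chi)/2}$ and $\widehat\pi_{\eta,g_{S_p}}(\chi)=\exp\int\big(\chi(x)-1-i\,g_{S_p}(x,\chi)\big)\,d\eta(x)$ for all characters $\chi$; both exist and are unique. Theorem (Gauss–Poisson limit theorem on the $p$-adic solenoid). Let $\{X_{n,k}: n\in\mathbb N,\ 1\le k\le K_n\}$ be a rowwise independent array of random elements of $S_p$. Suppose that there are $a=(a_0,a_1,\dots)\in S_p$, $b\ge 0$ and a Lévy measure $\eta$ on $S_p$ such that, as $n\to\infty$, (i) $\max_{1\le k\le K_n}\mathrm P\big(\exists\, j\le d: |\arg((X_{n,k})_j)|>\varepsilon\big)\to 0$ for all $d\in\mathbb Z_{\ge 0}$ and $\varepsilon>0$; (ii) $\exp\Big\{\frac{i}{p^d}\sum_{k=1}^{K_n}\mathrm E\,h(\arg((X_{n,k})_0))\Big\}\to a_d$ for all $d\in\mathbb Z_{\ge 0}$; (iii) $\sum_{k=1}^{K_n}\operatorname{Var}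 h(\arg((X_{n,k})_0))\to b+\int_{S_p}h(\arg y_0)^2\,d\eta(y)$; (iv) $\sum_{k=1}^{K_n}\mathrm E f(X_{n,k})\to\int_{S_p}f\,d\eta$ for every bounded continuous $f:S_p\to\mathbb R$ that vanishes on some neighbourhood of $e$. Then the array is infinitesimal, i.e. $\max_{1\le k\le K_n}\mathrm P(X_{n,k}\notin U)\to 0$ for every Borel neighbourhood $U$ of $e$, and the row sums $\sum_{k=1}^{K_n}X_{n,k}$ converge in distribution to $\delta_a*\gamma_{\psi_b}*\pi_{\eta,g_{S_p}}$. -/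

import Mathlib

open MeasureTheory ProbabilityTheory Filter Topology
open scoped BoundedContinuousFunction

/-! ### Measures on a topological abelian group

Groups are written multiplicatively, so the neutral element `e` is `1` and the sum of
group elements is a product. -/

section General

/-- The Fourier transform of a measure `μ` on `G`, as a function on the character group. -/
noncomputable def fourierTransform {G : Type*} [CommGroup G] [TopologicalSpace G]
    [MeasurableSpace G] (μ : Measure G) (χ : PontryaginDual G) : ℂ :=
  ∫ x, (χ x : ℂ) ∂μ

/-- A (possibly infinite) measure `η` on `G` is a Lévy measure if it has no mass at the neutral
element, is finite off every Borel neighbourhood of the neutral element, and integrates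
`1 - Re χ` for every character `χ`. -/
structure IsLevyMeasure {G : Type*} [CommGroup G] [TopologicalSpace G]
    [MeasurableSpace G] (η : Measure G) : Prop where
  measure_one : η {1} = 0
  measure_compl_lt_top : ∀ U : Set G, MeasurableSet U → U ∈ 𝓝 (1 : G) → η Uᶜ < ⊤
  lintegral_lt_top : ∀ χ : PontryaginDual G,
    ∫⁻ x, ENNReal.ofReal (1 - (χ x : ℂ).re) ∂η < ⊤

/-- `γ` is the symmetric Gauss measure with quadratic form `ψ`:
its Fourier transform is `exp (-ψ / 2)`. -/
def IsGaussMeasure {G : Type*} [CommGroup G] [TopologicalSpace G]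
    [MeasurableSpace G] (ψ : PontryaginDual G → ℝ) (γ : ProbabilityMeasure G) : Prop :=
  ∀ χ : PontryaginDual G,
    fourierTransform (γ : Measure G) χ = Complex.exp (-((ψ χ : ℝ) : ℂ) / 2)

/-- `π` is the generalized Poisson measure of the Lévy measure `η` with respect to the local
inner product `g`: its Fourier transform is `exp (∫ (χ x - 1 - i g(x, χ)) dη(x))`. -/
def IsGeneralizedPoisson {G : Type*} [CommGroup G] [TopologicalSpace G]
    [MeasurableSpace G] (η : Measure G) (g : G → PontryaginDual G → ℝ)
    (π : ProbabilityMeasure G) : Prop :=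
  ∀ χ : PontryaginDual G,
    fourierTransform (π : Measure G) χ =
      Complex.exp (∫ x, ((χ x : ℂ) - 1 - Complex.I * ((g x χ : ℝ) : ℂ)) ∂η)

/-- A triangular array `X n k`, `k < K n`, of random elements of `G` (the `n`-th row living on
the probability space `(Ω n, P n)`) is infinitesimal if
`max_k P (X n k ∉ U) → 0` for every Borel neighbourhood `U` of the neutral element. -/
def IsInfinitesimalArray {G : Type*} [CommGroup G] [TopologicalSpace G]
    [MeasurableSpace G] {Ω : ℕ → Type*} [∀ n, MeasurableSpace (Ω n)]
    (P : ∀ n, Measure (Ω n)) (K : ℕ → ℕ) (X : ∀ n, Fin (K n) → Ω n → G) : Prop :=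
  ∀ U : Set G, MeasurableSet U → U ∈ 𝓝 (1 : G) →
    Tendsto (fun n => ⨆ k : Fin (K n), P n {ω | X n k ω ∉ U}) atTop (𝓝 0)

end General

/-! ### The argument and the truncation function -/

/-- The argument of a point of the unit circle, with values in `[-π, π)`
(`Complex.arg` has values in `(-π, π]`). -/
noncomputable def circleArg (z : Circle) : ℝ :=
  if Complex.arg (z : ℂ) = Real.pi then -Real.pi else Complex.arg (z : ℂ)

/-- The truncation function `h`. -/
noncomputable def truncH (x : ℝ) : ℝ :=
  if x < -Real.pi ∨ Real.pi ≤ x then 0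
  else if x < -(Real.pi / 2) then -x - Real.pi
  else if x < Real.pi / 2 then x
  else -x + Real.pi

/-! ### The `p`-adic solenoid and its characters -/

/-- The `p`-adic solenoid: the sequences `(y₀, y₁, …)` on the circle with `y_j = y_{j+1} ^ p`,
with the topology and the Borel structure induced from the product of circles. -/
def solenoid (p : ℕ) : Subgroup (ℕ → Circle) where
  carrier := {y | ∀ j, y j = y (j + 1) ^ p}
  mul_mem' := by
    intro a b ha hb j
    simp only [Pi.mul_apply, mul_pow]
    rw [← ha j, ← hb j]
  one_mem' := by intro j; simp
  inv_mem' := by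
    intro a ha j
    simp only [Pi.inv_apply, inv_pow]
    rw [← ha j]

noncomputable instance instMeasurableSpaceSolenoid (p : ℕ) : MeasurableSpace (solenoid p) :=
  borel (solenoid p)

instance instBorelSpaceSolenoid (p : ℕ) : BorelSpace (solenoid p) := ⟨rfl⟩

instance instSecondCountableTopologySolenoid (p : ℕ) : SecondCountableTopology (solenoid p) :=
  TopologicalSpace.Subtype.secondCountableTopology {y : ℕ → Circle | y ∈ solenoid p}

/-- The character `χ_{d,ℓ}(y) = y_d ^ ℓ`. -/
noncomputable def solenoidChar (p d : ℕ) (l : ℤ) : PontryaginDual (solenoid p) :=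
  (⟨⟨⟨fun y => (y : ℕ → Circle) d ^ l, by simp⟩, by intro x y; simp [mul_zpow]⟩,
    by
      have h : Continuous fun y : solenoid p => (y : ℕ → Circle) d :=
        (continuous_apply d).comp continuous_subtype_val
      exact h.zpow l⟩ : solenoid p →ₜ* Circle)

@[simp]
theorem solenoidChar_apply (p d : ℕ) (l : ℤ) (y : solenoid p) :
    solenoidChar p d l y = (y : ℕ → Circle) d ^ l := rfl

/-- The one-parameter subgroup `t ↦ (exp (i t / p ^ j))_j` of the solenoid. -/
noncomputable def solenoidLine (p : ℕ) (hp : p ≠ 0) (t : ℝ) : solenoid p :=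
  ⟨fun j => Circle.exp (t / (p : ℝ) ^ j), by
    intro j
    have hp' : (p : ℝ) ≠ 0 := by exact_mod_cast hp
    rw [← Circle.exp_natCast_mul]
    rw [pow_succ]
    field_simp⟩

theorem solenoidLine_coe (p : ℕ) (hp : p ≠ 0) (t : ℝ) (j : ℕ) :
    (solenoidLine p hp t : ℕ → Circle) j = Circle.exp (t / (p : ℝ) ^ j) := rfl

theorem solenoidLine_add (p : ℕ) (hp : p ≠ 0) (s t : ℝ) :
    solenoidLine p hp (s + t) = solenoidLine p hp s * solenoidLine p hp t := by
  apply Subtype.ext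
  funext j
  simp [solenoidLine_coe, add_div, Circle.exp_add]

theorem continuous_solenoidLine (p : ℕ) (hp : p ≠ 0) : Continuous (solenoidLine p hp) := by
  refine Continuous.subtype_mk (continuous_pi fun j => ?_) _
  exact Circle.exp.continuous.comp (continuous_id.div_const _)

/-- A continuous homomorphism from `ℝ` to the circle is `t ↦ exp (i c t)`. -/
theorem exists_frequency_of_hom (φ : ℝ → Circle) (hc : Continuous φ)
    (hadd : ∀ s t, φ (s + t) = φ s * φ t) : ∃ c : ℝ, ∀ t, φ t = Circle.exp (c * t) := by
  let f : ℝ → ℂ := fun t => (φ t : ℂ)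
  have hf : Continuous f := continuous_subtype_val.comp hc
  have h0 : φ 0 = 1 := by
    have := hadd 0 0
    simpa using this
  have hfadd : ∀ s t, f (s + t) = f s * f t := fun s t => by
    simp [f, hadd]
  let F : ℝ → ℂ := fun x => ∫ t in (0 : ℝ)..x, f t
  have hF : ∀ x, HasDerivAt F (f x) x := fun x => hf.integral_hasStrictDerivAt 0 x |>.hasDerivAt
  obtain ⟨a, ha⟩ : ∃ a, F a ≠ 0 := by
    by_contra! h
    have h1 : F = fun _ => 0 := funext h
    have h2 := hF 0
    rw [h1] at h2
    have h3 := h2.unique (hasDerivAt_const (0 : ℝ) (0 : ℂ))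
    simp [f, h0] at h3
  have key : ∀ t, f t = (F (t + a) - F t) / F a := by
    intro t
    rw [eq_div_iff ha]
    have e1 : F (t + a) - F t = ∫ s in t..(t + a), f s :=
      intervalIntegral.integral_interval_sub_left (hf.intervalIntegrable _ _)
        (hf.intervalIntegrable _ _)
    rw [e1]
    have e2 : ∫ s in t..(t + a), f s = ∫ s in (0 : ℝ)..a, f (t + s) := by
      rw [intervalIntegral.integral_comp_add_left]
      simp
    rw [e2]
    simp only [hfadd, F]
    rw [intervalIntegral.integral_const_mul]
  let κ : ℂ := (f a - 1) / F a
  have hder : ∀ t, HasDerivAt f (κ * f t) t := by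
    intro t
    have h1 : HasDerivAt (fun t => (F (t + a) - F t) / F a) ((f (t + a) - f t) / F a) t :=
      (((hF (t + a)).comp_add_const t a).sub (hF t)).div_const _
    have h2 : f = fun t => (F (t + a) - F t) / F a := funext key
    have h3 : (f (t + a) - f t) / F a = κ * f t := by
      simp only [κ, hfadd]
      ring
    rw [h3, ← h2] at h1
    exact h1
  have hconst : ∀ t : ℝ, f t * Complex.exp (-(κ * t)) = 1 := by
    have hd : ∀ t : ℝ, HasDerivAt (fun t : ℝ => f t * Complex.exp (-(κ * t))) 0 t := by
      intro t
      have h1 : HasDerivAt (fun t : ℝ => -(κ * (t : ℂ))) (-κ) t := by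
        simpa using ((Complex.ofRealCLM.hasDerivAt (x := t)).const_mul κ).fun_neg
      exact ((hder t).fun_mul h1.cexp).congr_deriv (by ring)
    intro t
    have h3 := is_const_of_deriv_eq_zero (fun t => (hd t).differentiableAt)
      (fun t => (hd t).deriv) t 0
    simpa [f, h0] using h3
  have hexp : ∀ t : ℝ, f t = Complex.exp (κ * t) := by
    intro t
    have h1 := hconst t
    rw [Complex.exp_neg] at h1
    field_simp at h1
    exact h1
  have hre : κ.re = 0 := by
    have h1 : ‖f 1‖ = 1 := Circle.norm_coe _
    rw [hexp 1, Complex.norm_exp] at h1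
    simpa using h1
  refine ⟨κ.im, fun t => Circle.ext ?_⟩
  have h1 : κ = κ.im * Complex.I := by
    apply Complex.ext <;> simp [hre]
  rw [Circle.coe_exp]
  change f t = _
  rw [hexp t]
  conv_lhs => rw [h1]
  congr 1
  push_cast
  ring

/-- Every character of the solenoid is one of the `χ_{d,ℓ}`. -/
theorem exists_eq_solenoidChar (p : ℕ) (hp : p ≠ 0) (χ : PontryaginDual (solenoid p)) :
    ∃ (d : ℕ) (l : ℤ), χ = solenoidChar p d l := by
  have hp' : (p : ℝ) ≠ 0 := by exact_mod_cast hp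
  have hχ : Continuous χ := map_continuous χ
  obtain ⟨c, hc⟩ := exists_frequency_of_hom (fun t => χ (solenoidLine p hp t))
    (hχ.comp (continuous_solenoidLine p hp))
    (fun s t => by rw [solenoidLine_add, map_mul])
  obtain ⟨d, hd⟩ : ∃ d : ℕ, ∀ y : solenoid p, (y : ℕ → Circle) d = 1 → χ y = 1 := by
    have hV : χ ⁻¹' (Circle.centeredArc (Real.pi / 2)) ∈ 𝓝 (1 : solenoid p) := by
      refine ((Circle.isOpen_centeredArc _).preimage hχ).mem_nhds ?_
      rw [Set.mem_preimage, map_one, Circle.mem_centeredArc (by linarith [Real.pi_pos])]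
      simp [Real.pi_pos]
    rw [nhds_subtype_eq_comap, Filter.mem_comap] at hV
    obtain ⟨W, hW, hWV⟩ := hV
    rw [nhds_pi, Filter.mem_pi] at hW
    obtain ⟨I, hI, t, ht, htW⟩ := hW
    obtain ⟨d, hd⟩ := hI.bddAbove
    refine ⟨d, fun y hy => ?_⟩
    have hdown : ∀ m j : ℕ, j + m = d → (y : ℕ → Circle) j = 1 := by
      intro m
      induction m with
      | zero => intro j hj; rw [← hy, ← hj, add_zero]
      | succ m ih =>
        intro j hj
        rw [y.2 j, ih (j + 1) (by omega), one_pow]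
    have hker : ∀ j ∈ I, (y : ℕ → Circle) j = 1 := fun j hj =>
      hdown (d - j) j (by have := hd hj; omega)
    refine Circle.eq_one_of_forall_pow_mem_centeredArc_pi_div_two fun n _ => ?_
    rw [← map_pow]
    apply hWV
    apply htW
    intro j hj
    have : ((y ^ n : solenoid p) : ℕ → Circle) j = 1 := by
      simp [hker j hj]
    rw [this]
    exact mem_of_mem_nhds (ht j)
  have h1 : χ (solenoidLine p hp (2 * Real.pi * (p : ℝ) ^ d)) = 1 := by
    apply hd
    rw [solenoidLine_coe]
    rw [mul_div_assoc, div_self (pow_ne_zero _ hp'), mul_one, Circle.exp_two_pi]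
  rw [hc] at h1
  obtain ⟨l, hl⟩ := Circle.exp_eq_one.mp h1
  have hcl : c * (p : ℝ) ^ d = l := by
    have : (2 * Real.pi) ≠ 0 := by positivity
    apply mul_right_cancel₀ this
    linarith
  refine ⟨d, l, PontryaginDual.ext fun y => ?_⟩
  obtain ⟨s, hs⟩ : ∃ s : ℝ, (y : ℕ → Circle) d = Circle.exp s :=
    ⟨Complex.arg ((y : ℕ → Circle) d : ℂ), (Circle.exp_arg _).symm⟩
  have h2 : χ (y * (solenoidLine p hp ((p : ℝ) ^ d * s))⁻¹) = 1 := by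
    apply hd
    simp only [Subgroup.coe_mul, Subgroup.coe_inv, Pi.mul_apply, Pi.inv_apply, solenoidLine_coe]
    rw [mul_div_cancel_left₀ _ (pow_ne_zero _ hp'), hs, mul_inv_cancel]
  rw [map_mul, map_inv, mul_inv_eq_one, hc] at h2
  rw [h2, solenoidChar_apply, hs, ← Circle.exp_intCast_mul]
  congr 1
  rw [← hcl]
  ring

/-- The number `ℓ / p ^ d` attached to a character `χ = χ_{d,ℓ}`. -/
noncomputable def solenoidFreq (p : ℕ) [hp : Fact p.Prime] (χ : PontryaginDual (solenoid p)) : ℝ :=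
  ((exists_eq_solenoidChar p hp.out.ne_zero χ).choose_spec.choose : ℝ) /
    (p : ℝ) ^ (exists_eq_solenoidChar p hp.out.ne_zero χ).choose

/-- `ℓ / p ^ d` depends only on the character `χ_{d,ℓ}`. -/
theorem div_eq_div_of_solenoidChar_eq (p : ℕ) (hp : p ≠ 0) (d d' : ℕ) (l l' : ℤ)
    (h : solenoidChar p d l = solenoidChar p d' l') :
    (l : ℝ) / (p : ℝ) ^ d = (l' : ℝ) / (p : ℝ) ^ d' := by
  have h1 : ∀ t : ℝ, Circle.exp (((l : ℝ) / (p : ℝ) ^ d - (l' : ℝ) / (p : ℝ) ^ d') * t) = 1 := by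
    intro t
    have h2 := DFunLike.congr_fun h (solenoidLine p hp t)
    simp only [solenoidChar_apply, solenoidLine_coe] at h2
    rw [← Circle.exp_intCast_mul, ← Circle.exp_intCast_mul] at h2
    rw [sub_mul, Circle.exp_sub, div_eq_one]
    convert h2 using 2 <;> ring
  by_contra hne
  have hne' := sub_ne_zero.mpr hne
  have h3 := h1 (Real.pi / ((l : ℝ) / (p : ℝ) ^ d - (l' : ℝ) / (p : ℝ) ^ d'))
  rw [mul_div_cancel₀ _ hne'] at h3
  exact Circle.exp_pi_ne_one h3

theorem solenoidFreq_solenoidChar (p : ℕ) [hp : Fact p.Prime] (d : ℕ) (l : ℤ) :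
    solenoidFreq p (solenoidChar p d l) = (l : ℝ) / (p : ℝ) ^ d :=
  (div_eq_div_of_solenoidChar_eq p hp.out.ne_zero _ _ _ _
    (exists_eq_solenoidChar p hp.out.ne_zero (solenoidChar p d l)).choose_spec.choose_spec).symm

/-- The quadratic form `ψ_b (χ_{d,ℓ}) = b ℓ ^ 2 / p ^ (2 d)`. -/
noncomputable def solenoidQuadraticForm (p : ℕ) [Fact p.Prime] (b : ℝ)
    (χ : PontryaginDual (solenoid p)) : ℝ :=
  b * solenoidFreq p χ ^ 2

theorem solenoidQuadraticForm_solenoidChar (p : ℕ) [Fact p.Prime] (b : ℝ) (d : ℕ) (l : ℤ) :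
    solenoidQuadraticForm p b (solenoidChar p d l) = b * (l : ℝ) ^ 2 / (p : ℝ) ^ (2 * d) := by
  rw [solenoidQuadraticForm, solenoidFreq_solenoidChar, div_pow, ← pow_mul, mul_comm d 2,
    mul_div_assoc]

/-- The local inner product `g (y, χ_{d,ℓ}) = ℓ h(arg y₀) / p ^ d`. -/
noncomputable def solenoidInner (p : ℕ) [Fact p.Prime] (y : solenoid p)
    (χ : PontryaginDual (solenoid p)) : ℝ :=
  solenoidFreq p χ * truncH (circleArg ((y : ℕ → Circle) 0))

theorem solenoidInner_solenoidChar (p : ℕ) [Fact p.Prime] (y : solenoid p) (d : ℕ) (l : ℤ) :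
    solenoidInner p y (solenoidChar p d l) =
      (l : ℝ) * truncH (circleArg ((y : ℕ → Circle) 0)) / (p : ℝ) ^ d := by
  rw [solenoidInner, solenoidFreq_solenoidChar, div_mul_eq_mul_div]

/-! The characters of the solenoid separate points and span a star algebra, so on this compact
Polish group pointwise convergence of Fourier transforms is weak convergence
(`tendsto_of_tendsto_fourierTransform`). Independence turns the transform of a row sum into a
product, and it remains to find the limit of that product for one character χ = χ_{d,ℓ} of frequency
c = ℓ/p^d.

Put Y(y) = h(arg y₀), a continuous function. Near e one has χ = exp(icY) exactly
(`eventually_char_eq_exp`), so the problem behaves like the classical one on the line. Centre each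
factor by exp(-icm), where m is the mean of Y under the law of X_{n,k}. The centred factor minus 1
is the integral of three terms: a unimodular multiple of χ - exp(icY), which vanishes near e and is
governed by (iv); the second-order Taylor remainder of exp(ic(Y - m)); and -(c²/2)(Y - m)², governed
by (iii). The remainder does not vanish near e, but there it is at most a small multiple of (Y -
m)², so the bounded sum of variances makes that part negligible
(`tendsto_sum_integral_expRemainder`). In the limit the ∫Y² dη from (iii) recombines with the first
two terms into ∫(χ - 1 - icY) dη, leaving -(c²/2)b for the Gauss factor.

Since the centred factors lie in the unit disc and are uniformly close to 1, their product tends to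
the exponential of the limit of the sums of z - 1 (`tendsto_prod_of_tendsto_sum_sub_one`). The
centring constants multiply to a factor that tends to χ(a) by (ii).

The Gauss measure is the image of a normal law under the line t ↦ (exp(it/p^j))_j. The generalized
Poisson measure is a limit of shifted compound Poisson measures, where compactness guarantees that a
limit of transforms is again a transform. -/

section CharacterAlgebra

/-! ### Characters and trigonometric polynomials -/

variable {G : Type*} [CommGroup G] [TopologicalSpace G]

/-- A character as a bounded continuous complex function. -/
noncomputable def charBCF (χ : PontryaginDual G) : G →ᵇ ℂ :=
  BoundedContinuousFunction.ofNormedAddCommGroup (fun x => (χ x : ℂ))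
    (continuous_subtype_val.comp (map_continuous χ)) 1 (fun x => (Circle.norm_coe (χ x)).le)

@[simp]
theorem charBCF_apply (χ : PontryaginDual G) (x : G) : charBCF χ x = (χ x : ℂ) := rfl

theorem span_charBCF_mul_mem {f g : G →ᵇ ℂ}
    (hf : f ∈ Submodule.span ℂ (Set.range (charBCF (G := G))))
    (hg : g ∈ Submodule.span ℂ (Set.range (charBCF (G := G)))) :
    f * g ∈ Submodule.span ℂ (Set.range (charBCF (G := G))) := by
  have h := Submodule.mul_mem_mul hf hg
  rw [Submodule.span_mul_span] at h
  refine Submodule.span_mono ?_ h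
  rintro _ ⟨_, ⟨χ, rfl⟩, _, ⟨ψ, rfl⟩, rfl⟩
  exact ⟨χ * ψ, by ext x; exact Circle.coe_mul (χ x) (ψ x)⟩

theorem span_charBCF_star_mem {f : G →ᵇ ℂ}
    (hf : f ∈ Submodule.span ℂ (Set.range (charBCF (G := G)))) :
    star f ∈ Submodule.span ℂ (Set.range (charBCF (G := G))) := by
  induction hf using Submodule.span_induction with
  | mem x h =>
    obtain ⟨χ, rfl⟩ := h
    refine Submodule.subset_span ⟨χ⁻¹, ?_⟩
    ext x
    exact Circle.coe_inv_eq_conj (χ x)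
  | zero => simp
  | add x y _ _ hx hy => rw [star_add]; exact add_mem hx hy
  | smul a x _ hx => rw [star_smul]; exact Submodule.smul_mem _ _ hx

/-- The trigonometric polynomials on `G`: the linear span of the characters. -/
noncomputable def trigPoly (G : Type*) [CommGroup G] [TopologicalSpace G] :
    StarSubalgebra ℂ (G →ᵇ ℂ) where
  carrier := Submodule.span ℂ (Set.range (charBCF (G := G)))
  mul_mem' := span_charBCF_mul_mem
  add_mem' := add_mem
  algebraMap_mem' c := by
    have h1 : charBCF (1 : PontryaginDual G) = 1 := by ext x; exact Circle.coe_one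
    rw [Algebra.algebraMap_eq_smul_one, ← h1]
    exact Submodule.smul_mem _ _ (Submodule.subset_span ⟨1, rfl⟩)
  star_mem' := span_charBCF_star_mem

theorem charBCF_mem_trigPoly (χ : PontryaginDual G) : charBCF χ ∈ trigPoly G :=
  Submodule.subset_span ⟨χ, rfl⟩

theorem separatesPoints_trigPoly
    (hsep : ∀ x y : G, x ≠ y → ∃ χ : PontryaginDual G, χ x ≠ χ y) :
    ((trigPoly G).map (BoundedContinuousFunction.toContinuousMapStarₐ ℂ)).SeparatesPoints := by
  intro x y hxy
  obtain ⟨χ, hχ⟩ := hsep x y hxy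
  refine ⟨charBCF χ, ⟨_, ⟨charBCF χ, charBCF_mem_trigPoly χ, rfl⟩, rfl⟩, ?_⟩
  simpa using fun h => hχ (Circle.ext h)

end CharacterAlgebra

/-! ### Fourier transforms and weak convergence on compact groups -/

section FourierTransform

variable {G : Type*} [CommGroup G] [TopologicalSpace G] [MeasurableSpace G]

theorem fourierTransform_eq_integral_charBCF (μ : Measure G) (χ : PontryaginDual G) :
    fourierTransform μ χ = ∫ x, charBCF χ x ∂μ := rfl

theorem tendsto_integral_of_mem_trigPoly [OpensMeasurableSpace G] {ι : Type*} {F : Filter ι}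
    {μ : ι → ProbabilityMeasure G} {μ₀ : ProbabilityMeasure G}
    (h : ∀ χ, Tendsto (fun i => fourierTransform (μ i : Measure G) χ) F
      (𝓝 (fourierTransform (μ₀ : Measure G) χ)))
    {g : G →ᵇ ℂ} (hg : g ∈ trigPoly G) :
    Tendsto (fun i => ∫ x, g x ∂(μ i : Measure G)) F (𝓝 (∫ x, g x ∂(μ₀ : Measure G))) := by
  replace hg : g ∈ Submodule.span ℂ (Set.range (charBCF (G := G))) := hg
  induction hg using Submodule.span_induction with
  | mem x hx => obtain ⟨χ, rfl⟩ := hx; exact h χ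
  | zero => simpa using tendsto_const_nhds
  | add f g _ _ hf hg =>
    have hadd : ∀ ν : ProbabilityMeasure G, ∫ x, (f + g) x ∂(ν : Measure G) =
        ∫ x, f x ∂(ν : Measure G) + ∫ x, g x ∂(ν : Measure G) := fun ν =>
      integral_add (f.integrable _) (g.integrable _)
    simp only [hadd]
    exact hf.add hg
  | smul a f _ hf =>
    have hsmul : ∀ ν : ProbabilityMeasure G, ∫ x, (a • f) x ∂(ν : Measure G) =
        a • ∫ x, f x ∂(ν : Measure G) := fun ν => integral_smul a f
    simp only [hsmul]
    exact hf.const_smul a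

variable [BorelSpace G]

/-- On a compact group whose characters separate points, pointwise convergence of Fourier
transforms to that of a probability measure implies weak convergence. -/
theorem tendsto_of_tendsto_fourierTransform [CompactSpace G] [PolishSpace G]
    (hsep : ∀ x y : G, x ≠ y → ∃ χ : PontryaginDual G, χ x ≠ χ y)
    {ι : Type*} {F : Filter ι} {μ : ι → ProbabilityMeasure G} {μ₀ : ProbabilityMeasure G}
    (h : ∀ χ, Tendsto (fun i => fourierTransform (μ i : Measure G) χ) F
      (𝓝 (fourierTransform (μ₀ : Measure G) χ))) :
    Tendsto μ F (𝓝 μ₀) :=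
  ProbabilityMeasure.tendsto_of_tight_of_separatesPoints ℂ IsTightMeasureSet.of_compactSpace
    (separatesPoints_trigPoly hsep) fun _ hg => tendsto_integral_of_mem_trigPoly h hg

/-- Equal transforms give equal integrals of trigonometric polynomials, a separating star algebra,
which determines a finite measure on a Polish space. This yields the uniqueness of the Gauss and
Poisson measures. -/
theorem eq_of_fourierTransform_eq [PolishSpace G]
    (hsep : ∀ x y : G, x ≠ y → ∃ χ : PontryaginDual G, χ x ≠ χ y)
    {μ ν : ProbabilityMeasure G}
    (h : ∀ χ, fourierTransform (μ : Measure G) χ = fourierTransform (ν : Measure G) χ) :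
    μ = ν := by
  refine Subtype.ext (ext_of_forall_mem_subalgebra_integral_eq_of_polish
    (P := (μ : Measure G)) (P' := (ν : Measure G)) (separatesPoints_trigPoly hsep)
    fun g hg => ?_)
  have h1 : ∀ χ, Tendsto (fun _ : ℕ => fourierTransform (μ : Measure G) χ) atTop
      (𝓝 (fourierTransform (ν : Measure G) χ)) := fun χ => by
    rw [h χ]; exact tendsto_const_nhds
  exact tendsto_nhds_unique tendsto_const_nhds (tendsto_integral_of_mem_trigPoly h1 hg)

/-- On a compact group, a pointwise limit of Fourier transforms of probability measures is the
Fourier transform of a probability measure. -/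
theorem exists_fourierTransform_eq_of_tendsto [CompactSpace G] [PolishSpace G]
    {μ : ℕ → ProbabilityMeasure G} {φ : PontryaginDual G → ℂ}
    (h : ∀ χ, Tendsto (fun n => fourierTransform (μ n : Measure G) χ) atTop (𝓝 (φ χ))) :
    ∃ μ₀ : ProbabilityMeasure G, ∀ χ, fourierTransform (μ₀ : Measure G) χ = φ χ := by
  have hc : IsCompact (closure (Set.range μ)) :=
    isCompact_closure_of_isTightMeasureSet IsTightMeasureSet.of_compactSpace
  -- Compactness gives a limit along an ultrafilter finer than `atTop`; the assumed convergence of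
  -- transforms identifies the transform of that limit.
  let U : Ultrafilter ℕ := Ultrafilter.of atTop
  obtain ⟨μ₀, -, hμ₀⟩ := hc.ultrafilter_le_nhds (U.map μ)
    (.trans (by simp) (monotone_principal subset_closure))
  refine ⟨μ₀, fun χ => ?_⟩
  have h1 : Tendsto μ U (𝓝 μ₀) := hμ₀
  rw [ProbabilityMeasure.tendsto_iff_forall_integral_rclike_tendsto ℂ] at h1
  exact tendsto_nhds_unique (h1 (charBCF χ)) ((h χ).mono_left (Ultrafilter.of_le atTop))

omit [BorelSpace G] in
theorem fourierTransform_dirac [OpensMeasurableSpace G] (a : G) (χ : PontryaginDual G) :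
    fourierTransform (Measure.dirac a) χ = (χ a : ℂ) := by
  rw [fourierTransform_eq_integral_charBCF,
    integral_dirac' _ _ (charBCF χ).continuous.stronglyMeasurable, charBCF_apply]

omit [BorelSpace G] in
theorem fourierTransform_mconv [OpensMeasurableSpace G] [MeasurableMul₂ G] (μ ν : Measure G)
    [IsFiniteMeasure μ] [IsFiniteMeasure ν] (χ : PontryaginDual G) :
    fourierTransform (μ ∗ₘ ν) χ = fourierTransform μ χ * fourierTransform ν χ := by
  rw [fourierTransform_eq_integral_charBCF, integral_mconv ((charBCF χ).integrable _)]
  simp only [charBCF_apply, map_mul, Circle.coe_mul, integral_const_mul, integral_mul_const]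
  rfl

theorem exists_fourierTransform_eq_mul [MeasurableMul₂ G] (μ ν : ProbabilityMeasure G) :
    ∃ ρ : ProbabilityMeasure G, ∀ χ, fourierTransform (ρ : Measure G) χ =
      fourierTransform (μ : Measure G) χ * fourierTransform (ν : Measure G) χ :=
  ⟨⟨(μ : Measure G) ∗ₘ (ν : Measure G), inferInstance⟩,
    fun χ => fourierTransform_mconv _ _ χ⟩

theorem exists_fourierTransform_eq_pow [MeasurableMul₂ G] (μ : ProbabilityMeasure G) (n : ℕ) :
    ∃ ρ : ProbabilityMeasure G, ∀ χ, fourierTransform (ρ : Measure G) χ =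
      fourierTransform (μ : Measure G) χ ^ n := by
  induction n with
  | zero => exact ⟨⟨Measure.dirac 1, inferInstance⟩, fun χ => by
      simp [fourierTransform_dirac]⟩
  | succ n ih =>
    obtain ⟨ρ, hρ⟩ := ih
    obtain ⟨σ, hσ⟩ := exists_fourierTransform_eq_mul ρ μ
    exact ⟨σ, fun χ => by rw [hσ, hρ, pow_succ]⟩

/-- Existence of the compound Poisson measure of a finite measure on a compact group. -/
theorem exists_compoundPoisson [CompactSpace G] [PolishSpace G] [MeasurableMul₂ G]
    (ν : Measure G) [IsFiniteMeasure ν] :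
    ∃ ρ : ProbabilityMeasure G, ∀ χ, fourierTransform (ρ : Measure G) χ =
      Complex.exp (∫ x, ((χ x : ℂ) - 1) ∂ν) := by
  -- Poisson approximation: the n-th convolution power of (1 - |ν|/n)δ₁ + ν/n has transform (1 +
  -- z/n)^n with z = ∫(χ - 1)dν. The weights are nonnegative only for n ≥ |ν|; for other n any
  -- measure will do.
  have hstep : ∀ n : ℕ, ∃ ρ : ProbabilityMeasure G, ν.real Set.univ ≤ n → 0 < n → ∀ χ,
      fourierTransform (ρ : Measure G) χ = (1 + (∫ x, ((χ x : ℂ) - 1) ∂ν) / n) ^ n := by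
    intro n
    by_cases hn : ν.real Set.univ ≤ n ∧ 0 < n
    swap
    · exact ⟨⟨Measure.dirac 1, inferInstance⟩, fun h1 h2 => absurd ⟨h1, h2⟩ hn⟩
    obtain ⟨hn, hn0⟩ := hn
    have hn0' : (0 : ℝ) < n := by exact_mod_cast hn0
    set q : ℝ := 1 - ν.real Set.univ / n with hq
    have hq0 : 0 ≤ q := sub_nonneg.mpr ((div_le_one hn0').mpr hn)
    let m : Measure G := ENNReal.ofReal q • Measure.dirac 1 + ENNReal.ofReal ((n : ℝ)⁻¹) • ν
    have hm : IsProbabilityMeasure m := by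
      constructor
      simp only [m, Measure.add_apply, Measure.smul_apply, smul_eq_mul, measure_univ, mul_one]
      rw [← ofReal_measureReal (measure_ne_top ν _), ← ENNReal.ofReal_mul (by positivity),
        ← ENNReal.ofReal_add hq0 (by positivity), hq]
      rw [← ENNReal.ofReal_one]
      congr 1
      ring
    obtain ⟨ρ, hρ⟩ := exists_fourierTransform_eq_pow (⟨m, hm⟩ : ProbabilityMeasure G) n
    refine ⟨ρ, fun _ _ χ => ?_⟩
    rw [hρ]
    congr 1
    have h1 : fourierTransform m χ = q + (n : ℂ)⁻¹ * ∫ x, (χ x : ℂ) ∂ν := by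
      have hi : ∀ μ' : Measure G, IsFiniteMeasure μ' → Integrable (fun x => (χ x : ℂ)) μ' :=
        fun μ' _ => (charBCF χ).integrable μ'
      have h2 : fourierTransform (Measure.dirac 1) χ = 1 := by simp [fourierTransform_dirac]
      have h3 : fourierTransform m χ = ∫ x, (χ x : ℂ) ∂m := rfl
      rw [h3, integral_add_measure ((hi _ inferInstance).smul_measure ENNReal.ofReal_ne_top)
        ((hi _ inferInstance).smul_measure ENNReal.ofReal_ne_top), integral_smul_measure,
        integral_smul_measure]
      change _ • fourierTransform (Measure.dirac 1) χ + _ = _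
      rw [h2, ENNReal.toReal_ofReal hq0, ENNReal.toReal_ofReal (by positivity)]
      simp [Complex.real_smul]
    have h4 : ∫ x, ((χ x : ℂ) - 1) ∂ν = (∫ x, (χ x : ℂ) ∂ν) - ν.real Set.univ := by
      have h5 : ∫ x, (charBCF χ x - 1) ∂ν = (∫ x, charBCF χ x ∂ν) - ν.real Set.univ := by
        rw [integral_sub ((charBCF χ).integrable ν) (integrable_const _)]
        simp
      exact h5
    change fourierTransform m χ = _
    rw [h1, h4, hq]
    push_cast
    ring
  choose ρ hρ using hstep
  refine exists_fourierTransform_eq_of_tendsto (μ := ρ) fun χ => ?_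
  refine (Complex.tendsto_one_add_div_pow_exp (∫ x, ((χ x : ℂ) - 1) ∂ν)).congr' ?_
  obtain ⟨N, hN⟩ := exists_nat_ge (ν.real Set.univ)
  filter_upwards [eventually_ge_atTop (N + 1)] with n hn
  refine (hρ n (hN.trans ?_) (by omega) χ).symm
  exact_mod_cast (by omega : N ≤ n)

end FourierTransform

/-! ### The truncated argument on the circle -/

section Truncation

theorem circleArg_mem_Ico (z : Circle) : circleArg z ∈ Set.Ico (-Real.pi) Real.pi := by
  rw [circleArg]
  split_ifs with h
  · exact ⟨le_rfl, by linarith [Real.pi_pos]⟩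
  · exact ⟨(Complex.neg_pi_lt_arg _).le, lt_of_le_of_ne (Complex.arg_le_pi _) h⟩

theorem exp_circleArg (z : Circle) : Circle.exp (circleArg z) = z := by
  rw [circleArg]
  split_ifs with h
  · rw [← Circle.exp_arg z, h, Circle.exp_eq_exp]
    exact ⟨-1, by push_cast; ring⟩
  · exact Circle.exp_arg z

theorem circle_exp_im (x : ℝ) : ((Circle.exp x : Circle) : ℂ).im = Real.sin x := by
  rw [Circle.coe_exp, Complex.exp_ofReal_mul_I_im]

theorem circle_exp_re (x : ℝ) : ((Circle.exp x : Circle) : ℂ).re = Real.cos x := by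
  rw [Circle.coe_exp, Complex.exp_ofReal_mul_I_re]

theorem sin_circleArg (z : Circle) : Real.sin (circleArg z) = (z : ℂ).im := by
  rw [← circle_exp_im, exp_circleArg]

/-- The three branches of h fold the circle onto [-π/2, π/2] while preserving the sine. Hence h(arg
z) = arcsin(Im z) is continuous although arg jumps at -1. -/
theorem truncH_eq_arcsin_sin {x : ℝ} (hx : x ∈ Set.Ico (-Real.pi) Real.pi) :
    truncH x = Real.arcsin (Real.sin x) := by
  obtain ⟨h1, h2⟩ := hx
  rw [truncH, if_neg (by rintro (h | h) <;> linarith)]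
  split_ifs with h3 h4
  · rw [← Real.arcsin_sin (x := -x - Real.pi) (by linarith) (by linarith), Real.sin_sub_pi,
      Real.sin_neg, neg_neg]
  · rw [Real.arcsin_sin (by linarith) (by linarith)]
  · rw [← Real.arcsin_sin (x := -x + Real.pi) (by linarith) (by linarith), Real.sin_add_pi,
      Real.sin_neg, neg_neg]

theorem truncH_circleArg (z : Circle) : truncH (circleArg z) = Real.arcsin (z : ℂ).im := by
  rw [truncH_eq_arcsin_sin (circleArg_mem_Ico z), sin_circleArg]

theorem abs_truncH_le_abs {x : ℝ} (hx : x ∈ Set.Ico (-Real.pi) Real.pi) : |truncH x| ≤ |x| := by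
  obtain ⟨h1, h2⟩ := hx
  have := Real.pi_pos
  rw [truncH, if_neg (by rintro (h | h) <;> linarith)]
  split_ifs with h3 h4
  · rw [abs_of_nonpos (by linarith), abs_of_nonpos (by linarith)]; linarith
  · exact le_rfl
  · rw [abs_of_nonneg (by linarith), abs_of_nonneg (by linarith)]; linarith

/-- Follows from |h(x)| ≤ |x| and cos x ≤ 1 - (2/π²)x² on [-π, π]. Since a Lévy measure integrates 1
- Re χ_{0,1}, it therefore integrates h(arg y₀)². -/
theorem truncH_circleArg_sq_le (z : Circle) :
    truncH (circleArg z) ^ 2 ≤ Real.pi ^ 2 / 2 * (1 - (z : ℂ).re) := by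
  have h1 : truncH (circleArg z) ^ 2 ≤ circleArg z ^ 2 :=
    sq_le_sq.mpr (abs_truncH_le_abs (circleArg_mem_Ico z))
  have h2 : |circleArg z| ≤ Real.pi :=
    abs_le.mpr ⟨(circleArg_mem_Ico z).1, (circleArg_mem_Ico z).2.le⟩
  have h3 := Real.cos_le_one_sub_mul_cos_sq h2
  have h4 : Real.cos (circleArg z) = (z : ℂ).re := by rw [← circle_exp_re, exp_circleArg]
  rw [h4] at h3
  have h5 : circleArg z ^ 2 ≤ Real.pi ^ 2 / 2 * (1 - (z : ℂ).re) := by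
    have hpi := Real.pi_pos
    calc circleArg z ^ 2 = Real.pi ^ 2 / 2 * (2 / Real.pi ^ 2 * circleArg z ^ 2) := by
          field_simp
      _ ≤ _ := by gcongr; linarith
  exact h1.trans h5

end Truncation

/-! ### The solenoid: topology, characters near e, and the Gauss measure -/

section Solenoid

variable (p : ℕ)

theorem isClosed_solenoid : IsClosed (solenoid p : Set (ℕ → Circle)) := by
  have h : (solenoid p : Set (ℕ → Circle)) = ⋂ j, {y | y j = y (j + 1) ^ p} := by
    ext y; simp only [Set.mem_iInter]; rfl
  rw [h]
  exact isClosed_iInter fun j => isClosed_eq (continuous_apply j) ((continuous_apply _).pow p)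

instance instCompactSpaceSolenoid : CompactSpace (solenoid p) :=
  isCompact_iff_compactSpace.mp (isClosed_solenoid p).isCompact

instance instPolishSpaceSolenoid : PolishSpace (solenoid p) := by
  have : PolishSpace Circle := 
    (Metric.isClosed_sphere (x := (0 : ℂ)) (ε := 1)).polishSpace
  exact (isClosed_solenoid p).polishSpace

theorem continuous_solenoid_apply (d : ℕ) :
    Continuous fun y : solenoid p => (y : ℕ → Circle) d :=
  (continuous_apply d).comp continuous_subtype_val

theorem exists_pontryaginDual_ne (x y : solenoid p) (h : x ≠ y) :
    ∃ χ : PontryaginDual (solenoid p), χ x ≠ χ y := by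
  by_contra! hχ
  exact h (Subtype.ext (funext fun d => by simpa using hχ (solenoidChar p d 1)))

/-- The truncated argument `h (arg y₀)` as a continuous function on the solenoid. -/
noncomputable def truncArg : C(solenoid p, ℝ) where
  toFun y := truncH (circleArg ((y : ℕ → Circle) 0))
  continuous_toFun := by
    simp only [truncH_circleArg]
    exact Real.continuous_arcsin.comp (Complex.continuous_im.comp
      (continuous_subtype_val.comp (continuous_solenoid_apply p 0)))

theorem truncArg_apply (y : solenoid p) :
    truncArg p y = truncH (circleArg ((y : ℕ → Circle) 0)) := rfl

theorem truncArg_one : truncArg p 1 = 0 := by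
  rw [truncArg_apply, truncH_circleArg]; simp

theorem solenoid_apply_zero_eq_pow (y : solenoid p) (d : ℕ) :
    (y : ℕ → Circle) 0 = (y : ℕ → Circle) d ^ p ^ d := by
  induction d with
  | zero => simp
  | succ d ih => rw [ih, y.2 d, ← pow_mul, pow_succ, mul_comm]

variable [hp : Fact p.Prime]

/-- Near the neutral element a character is the exponential of the local inner product. -/
theorem eventually_char_eq_exp (χ : PontryaginDual (solenoid p)) :
    ∀ᶠ y in 𝓝 (1 : solenoid p),
      (χ y : ℂ) = Complex.exp (Complex.I * ((solenoidFreq p χ * truncArg p y : ℝ) : ℂ)) := by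
  obtain ⟨d, l, rfl⟩ := exists_eq_solenoidChar p hp.out.ne_zero χ
  have hpd : (0 : ℝ) < (p : ℝ) ^ d := pow_pos (by exact_mod_cast hp.out.pos) d
  have hpd1 : (1 : ℝ) ≤ (p : ℝ) ^ d := one_le_pow₀ (by exact_mod_cast hp.out.one_le)
  have hpi := Real.pi_pos
  have hr : Real.pi / 2 / (p : ℝ) ^ d ≤ Real.pi :=
    (div_le_self (by positivity) hpd1).trans (by linarith)
  -- With s = arg y_d, this radius forces |p^d s| < π/2, so y₀ = exp(i p^d s) has truncated argument
  -- exactly p^d s, with no folding or winding.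
  have hU : (fun y : solenoid p => (y : ℕ → Circle) d) ⁻¹'
      Circle.centeredArc (Real.pi / 2 / (p : ℝ) ^ d) ∈ 𝓝 (1 : solenoid p) := by
    refine ((Circle.isOpen_centeredArc _).preimage (continuous_solenoid_apply p d)).mem_nhds ?_
    rw [Set.mem_preimage, Circle.mem_centeredArc hr]
    simp only [Subgroup.coe_one, Pi.one_apply, Circle.coe_one, Complex.arg_one, abs_zero]
    positivity
  filter_upwards [hU] with y hy
  rw [Set.mem_preimage, Circle.mem_centeredArc hr, lt_div_iff₀ hpd] at hy
  set s := Complex.arg ((y : ℕ → Circle) d : ℂ) with hs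
  have hyd : (y : ℕ → Circle) d = Circle.exp s := (Circle.exp_arg _).symm
  have hy0 : (y : ℕ → Circle) 0 = Circle.exp ((p : ℝ) ^ d * s) := by
    rw [solenoid_apply_zero_eq_pow p y d, hyd]
    rw [← Circle.exp_natCast_mul, Nat.cast_pow]
  have hbd := abs_lt.mp (show |(p : ℝ) ^ d * s| < Real.pi / 2 by
    rwa [abs_mul, abs_of_pos hpd, mul_comm])
  have hY : truncArg p y = (p : ℝ) ^ d * s := by
    rw [truncArg_apply, truncH_circleArg, hy0, circle_exp_im,
      Real.arcsin_sin hbd.1.le hbd.2.le]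
  rw [solenoidFreq_solenoidChar, hY, solenoidChar_apply, hyd, ← Circle.exp_intCast_mul,
    Circle.coe_exp, mul_comm]
  congr 3
  field_simp

variable {η : Measure (solenoid p)}

omit hp in
theorem IsLevyMeasure.integrable_truncArg_sq (hη : IsLevyMeasure η) :
    Integrable (fun y => truncArg p y ^ 2) η := by
  have h1 : Integrable (fun y : solenoid p => 1 - ((y : ℕ → Circle) 0 : ℂ).re) η := by
    refine ⟨(continuous_const.sub (Complex.continuous_re.comp (continuous_subtype_val.comp
      (continuous_solenoid_apply p 0)))).aestronglyMeasurable, ?_⟩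
    rw [hasFiniteIntegral_iff_ofReal]
    · simpa using hη.lintegral_lt_top (solenoidChar p 0 1)
    · refine Eventually.of_forall fun y => sub_nonneg.mpr ?_
      exact (Complex.re_le_norm _).trans (Circle.norm_coe _).le
  refine (h1.const_mul (Real.pi ^ 2 / 2)).mono' (by fun_prop) (Eventually.of_forall fun y => ?_)
  rw [Real.norm_of_nonneg (sq_nonneg _)]
  exact truncH_circleArg_sq_le _

/-- The Gauss measure with quadratic form `ψ_b`: the image of a normal law on the line. -/
theorem exists_isGaussMeasure {b : ℝ} (hb : 0 ≤ b) :
    ∃ γ : ProbabilityMeasure (solenoid p), IsGaussMeasure (solenoidQuadraticForm p b) γ := by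
  have hc := continuous_solenoidLine p hp.out.ne_zero
  refine ⟨⟨(gaussianReal 0 b.toNNReal).map (solenoidLine p hp.out.ne_zero),
    Measure.isProbabilityMeasure_map hc.aemeasurable⟩, fun χ => ?_⟩
  obtain ⟨d, l, rfl⟩ := exists_eq_solenoidChar p hp.out.ne_zero χ
  rw [fourierTransform_eq_integral_charBCF]
  change ∫ x, charBCF (solenoidChar p d l) x ∂(Measure.map _ _) = _
  rw [integral_map hc.aemeasurable (charBCF _).continuous.aestronglyMeasurable]
  have h1 : ∀ t : ℝ, charBCF (solenoidChar p d l) (solenoidLine p hp.out.ne_zero t) =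
      Complex.exp (((l : ℝ) / (p : ℝ) ^ d : ℝ) * t * Complex.I) := by
    intro t
    rw [charBCF_apply, solenoidChar_apply, solenoidLine_coe, ← Circle.exp_intCast_mul,
      Circle.coe_exp]
    congr 1
    push_cast
    ring
  simp only [h1]
  rw [← charFun_apply_real, charFun_gaussianReal, solenoidQuadraticForm,
    solenoidFreq_solenoidChar, Real.coe_toNNReal b hb]
  congr 1
  push_cast
  ring

/-- A shift along the line produces exp(ict) for all characters at once, because the local inner
product is linear in the frequency c. This realizes the compensator of the Poisson measure. -/
theorem fourierTransform_dirac_solenoidLine (t : ℝ) (χ : PontryaginDual (solenoid p)) :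
    fourierTransform (Measure.dirac (solenoidLine p hp.out.ne_zero t)) χ =
      Complex.exp (Complex.I * ((solenoidFreq p χ * t : ℝ) : ℂ)) := by
  rw [fourierTransform_dirac]
  obtain ⟨d, l, rfl⟩ := exists_eq_solenoidChar p hp.out.ne_zero χ
  rw [solenoidFreq_solenoidChar, solenoidChar_apply, solenoidLine_coe, ← Circle.exp_intCast_mul,
      Circle.coe_exp]
  congr 1
  push_cast
  ring

end Solenoid

/-! ### Estimates for the second-order Taylor remainder -/

section ExponentialBounds

/-- The Taylor remainder of order two of `x ↦ exp (i c x)`. -/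
noncomputable def expRemainder (c x : ℝ) : ℂ :=
  Complex.exp (Complex.I * ((c * x : ℝ) : ℂ)) - 1 - Complex.I * ((c * x : ℝ) : ℂ) +
    ((c * x : ℝ) : ℂ) ^ 2 / 2

theorem continuous_expRemainder (c : ℝ) : Continuous (expRemainder c) := by
  unfold expRemainder; fun_prop

theorem norm_expRemainder_le (c x : ℝ) :
    ‖expRemainder c x‖ ≤ |c * x| ^ 3 * Real.exp |c * x| := by
  have h := Complex.norm_exp_sub_sum_le_norm_mul_exp (Complex.I * ((c * x : ℝ) : ℂ)) 3
  have e : ∑ m ∈ Finset.range 3, (Complex.I * ((c * x : ℝ) : ℂ)) ^ m / (m.factorial : ℂ) =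
      1 + Complex.I * ((c * x : ℝ) : ℂ) - ((c * x : ℝ) : ℂ) ^ 2 / 2 := by
    simp [Finset.sum_range_succ, mul_pow, Nat.factorial]
    ring
  rw [e, norm_mul, Complex.norm_I, one_mul, Complex.norm_real, Real.norm_eq_abs] at h
  convert h using 2
  rw [expRemainder]
  ring

theorem norm_expRemainder_le_cube {c x M : ℝ} (hx : |x| ≤ M) :
    ‖expRemainder c x‖ ≤ |c| ^ 3 * Real.exp (|c| * M) * |x| ^ 3 := by
  refine (norm_expRemainder_le c x).trans ?_
  rw [abs_mul, mul_pow]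
  calc |c| ^ 3 * |x| ^ 3 * Real.exp (|c| * |x|) ≤ |c| ^ 3 * |x| ^ 3 * Real.exp (|c| * M) := by
        gcongr
    _ = _ := by ring

theorem norm_exp_I_mul_sub_exp_I_mul_le (x y : ℝ) :
    ‖Complex.exp (Complex.I * (x : ℂ)) - Complex.exp (Complex.I * (y : ℂ))‖ ≤ |x - y| := by
  have e : Complex.exp (Complex.I * (x : ℂ)) - Complex.exp (Complex.I * (y : ℂ)) =
      Complex.exp (Complex.I * (y : ℂ)) *
        (Complex.exp (Complex.I * ((x - y : ℝ) : ℂ)) - 1) := by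
    rw [mul_sub, ← Complex.exp_add, mul_one]
    congr 2
    push_cast
    ring
  rw [e, norm_mul, mul_comm Complex.I (y : ℂ), Complex.norm_exp_ofReal_mul_I, one_mul]
  exact Real.norm_exp_I_mul_ofReal_sub_one_le

/-- The Lipschitz bound on a bounded interval is what allows the row means to be dropped from the
remainder away from e. -/
theorem norm_expRemainder_sub_le {c x y M : ℝ} (hx : |x| ≤ M) (hy : |y| ≤ M) :
    ‖expRemainder c x - expRemainder c y‖ ≤ (2 * |c| + c ^ 2 * M) * |x - y| := by
  have e : expRemainder c x - expRemainder c y =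
      (Complex.exp (Complex.I * ((c * x : ℝ) : ℂ)) - Complex.exp (Complex.I * ((c * y : ℝ) : ℂ)))
        - Complex.I * ((c * x - c * y : ℝ) : ℂ) + (((c * x) ^ 2 - (c * y) ^ 2) / 2 : ℝ) := by
    simp only [expRemainder]; push_cast; ring
  have h1 := norm_exp_I_mul_sub_exp_I_mul_le (c * x) (c * y)
  have e1 : |c * x - c * y| = |c| * |x - y| := by rw [← mul_sub, abs_mul]
  have h2 : ‖Complex.I * ((c * x - c * y : ℝ) : ℂ)‖ = |c| * |x - y| := by
    rw [norm_mul, Complex.norm_I, one_mul, Complex.norm_real, Real.norm_eq_abs, e1]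
  have h3 : ‖((((c * x) ^ 2 - (c * y) ^ 2) / 2 : ℝ) : ℂ)‖ ≤ c ^ 2 * M * |x - y| := by
    rw [Complex.norm_real, Real.norm_eq_abs,
      show ((c * x) ^ 2 - (c * y) ^ 2) / 2 = c ^ 2 * ((x + y) / 2) * (x - y) by ring,
      abs_mul, abs_mul, abs_of_nonneg (sq_nonneg c)]
    gcongr
    rw [abs_le] at *
    constructor <;> linarith
  rw [e]
  refine (norm_add_le _ _).trans ((add_le_add ((norm_sub_le _ _).trans
    (add_le_add h1 h2.le)) h3).trans ?_)
  rw [e1]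
  linarith

end ExponentialBounds

/-! ### From products to exponentials of sums -/

section Products

/-- Telescoping: exchange one factor at a time, all the others having norm at most 1. -/
theorem norm_prod_sub_prod_le_sum {ι : Type*} (s : Finset ι) {a b : ι → ℂ}
    (ha : ∀ i ∈ s, ‖a i‖ ≤ 1) (hb : ∀ i ∈ s, ‖b i‖ ≤ 1) :
    ‖∏ i ∈ s, a i - ∏ i ∈ s, b i‖ ≤ ∑ i ∈ s, ‖a i - b i‖ := by
  classical
  induction s using Finset.induction_on with
  | empty => simp
  | insert i s hi ih =>
    rw [Finset.prod_insert hi, Finset.prod_insert hi, Finset.sum_insert hi]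
    have h1 := ih (fun j hj => ha j (Finset.mem_insert_of_mem hj))
      (fun j hj => hb j (Finset.mem_insert_of_mem hj))
    have h2 : ‖∏ j ∈ s, b j‖ ≤ 1 := by
      rw [norm_prod]
      exact Finset.prod_le_one (fun _ _ => norm_nonneg _)
        (fun j hj => hb j (Finset.mem_insert_of_mem hj))
    have h3 := ha i (Finset.mem_insert_self i s)
    calc ‖a i * ∏ j ∈ s, a j - b i * ∏ j ∈ s, b j‖
        = ‖(a i - b i) * ∏ j ∈ s, b j + a i * (∏ j ∈ s, a j - ∏ j ∈ s, b j)‖ := by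
          congr 1; ring
      _ ≤ ‖a i - b i‖ * ‖∏ j ∈ s, b j‖ + ‖a i‖ * ‖∏ j ∈ s, a j - ∏ j ∈ s, b j‖ := by
          rw [← norm_mul, ← norm_mul]; exact norm_add_le _ _
      _ ≤ ‖a i - b i‖ * 1 + 1 * ‖∏ j ∈ s, a j - ∏ j ∈ s, b j‖ := by gcongr
      _ ≤ _ := by linarith

/-- Row products of a uniformly small array in the unit disc converge to the exponential of the
limit of the row sums of `z - 1`. -/
theorem tendsto_prod_of_tendsto_sum_sub_one {K : ℕ → ℕ} {z : ∀ n, Fin (K n) → ℂ} {L : ℂ} {C : ℝ}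
    (h1 : ∀ n k, ‖z n k‖ ≤ 1) (h2 : ∀ ε > 0, ∀ᶠ n in atTop, ∀ k, ‖z n k - 1‖ ≤ ε)
    (h3 : ∀ᶠ n in atTop, ∑ k, ‖z n k - 1‖ ≤ C)
    (h4 : Tendsto (fun n => ∑ k, (z n k - 1)) atTop (𝓝 L)) :
    Tendsto (fun n => ∏ k, z n k) atTop (𝓝 (Complex.exp L)) := by
  have h5 : Tendsto (fun n => Complex.exp (∑ k, (z n k - 1))) atTop (𝓝 (Complex.exp L)) :=
    (Complex.continuous_exp.tendsto L).comp h4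
  have h6 : Tendsto (fun n => ∏ k, z n k - Complex.exp (∑ k, (z n k - 1))) atTop (𝓝 0) := by
    rw [Metric.tendsto_nhds]
    intro ε hε
    have hC : 0 < |C| + 1 := by positivity
    filter_upwards [h3, h2 (min 1 (ε / 2 / (|C| + 1))) (by positivity)] with n hn3 hn2
    rw [dist_zero_right, Complex.exp_sum]
    -- In the unit disc Re(z - 1) ≤ 0, so the comparison factors exp(z - 1) also lie in the disc.
    -- Each differs from z by at most |z - 1|², which is a small multiple of |z - 1|.
    have h7 : ∀ k, ‖Complex.exp (z n k - 1)‖ ≤ 1 := fun k => by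
      rw [Complex.norm_exp, Real.exp_le_one_iff, Complex.sub_re, Complex.one_re]
      linarith [(Complex.re_le_norm (z n k)).trans (h1 n k)]
    calc _ ≤ ∑ k, ‖z n k - Complex.exp (z n k - 1)‖ :=
          norm_prod_sub_prod_le_sum _ (fun k _ => h1 n k) (fun k _ => h7 k)
      _ ≤ ∑ k, ε / 2 / (|C| + 1) * ‖z n k - 1‖ := by
          refine Finset.sum_le_sum fun k _ => ?_
          have h8 := Complex.norm_exp_sub_one_sub_id_le ((hn2 k).trans (min_le_left _ _))
          rw [norm_sub_rev, show Complex.exp (z n k - 1) - z n k =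
            Complex.exp (z n k - 1) - 1 - (z n k - 1) by ring]
          refine h8.trans ?_
          rw [sq]
          gcongr
          exact (hn2 k).trans (min_le_right _ _)
      _ = ε / 2 / (|C| + 1) * ∑ k, ‖z n k - 1‖ := by rw [Finset.mul_sum]
      _ ≤ ε / 2 / (|C| + 1) * (|C| + 1) := by
          gcongr
          linarith [le_abs_self C]
      _ < ε := by rw [div_mul_cancel₀ _ hC.ne']; linarith
  simpa using h6.add h5

end Products

/-! ### Null arrays and convergence away from e -/

section MeasureArrays

variable {G : Type*} [TopologicalSpace G] [MeasurableSpace G] {K : ℕ → ℕ}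

/-- An array of measures is null at `e` if the mass off every neighbourhood of `e` tends to zero
uniformly along the rows. -/
def IsNullArray (e : G) (ν : ∀ n, Fin (K n) → Measure G) : Prop :=
  ∀ U ∈ 𝓝 e, ∀ ε > (0 : ℝ), ∀ᶠ n in atTop, ∀ k, (ν n k).real Uᶜ ≤ ε

/-- The row sums of an array of measures converge to `η` on continuous functions vanishing
near `e`. -/
def TendstoAwayFrom (e : G) (ν : ∀ n, Fin (K n) → Measure G) (η : Measure G) : Prop :=
  ∀ f : G → ℝ, Continuous f → (∀ᶠ y in 𝓝 e, f y = 0) →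
    Tendsto (fun n => ∑ k, ∫ y, f y ∂(ν n k)) atTop (𝓝 (∫ y, f y ∂η))

/-- A measure is finite off every neighbourhood of `e`. -/
def IsFiniteAwayFrom (e : G) (η : Measure G) : Prop :=
  ∀ U : Set G, MeasurableSet U → U ∈ 𝓝 e → η Uᶜ < ⊤

variable [CompactSpace G] [BorelSpace G] {e : G} {ν : ∀ n, Fin (K n) → Measure G} {η : Measure G}

theorem Continuous.integrable_of_compactSpace {E : Type*} [NormedAddCommGroup E]
    [SecondCountableTopologyEither G E] {f : G → E} (hf : Continuous f) (μ : Measure G)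
    [IsFiniteMeasure μ] : Integrable f μ := by
  obtain ⟨C, hC⟩ := isCompact_univ.exists_bound_of_continuousOn hf.continuousOn
  exact Integrable.of_bound hf.aestronglyMeasurable C
    (Eventually.of_forall fun x => hC x (Set.mem_univ x))

theorem IsFiniteAwayFrom.integrable {E : Type*} [NormedAddCommGroup E]
    [SecondCountableTopologyEither G E] (hη : IsFiniteAwayFrom e η) {f : G → E}
    (hf : Continuous f) (h0 : ∀ᶠ y in 𝓝 e, f y = 0) : Integrable f η := by
  obtain ⟨U, hU, hUo, heU⟩ := eventually_nhds_iff.mp h0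
  have hfin : IsFiniteMeasure (η.restrict Uᶜ) :=
    ⟨by simpa using hη U hUo.measurableSet (hUo.mem_nhds heU)⟩
  refine (integrableOn_iff_integrable_of_support_subset (s := Uᶜ) ?_).mp
    (hf.integrable_of_compactSpace _)
  intro y hy hyU
  exact hy (hU y hyU)

theorem TendstoAwayFrom.tendsto_complex [∀ n k, IsProbabilityMeasure (ν n k)]
    (h : TendstoAwayFrom e ν η) (hη : IsFiniteAwayFrom e η) {f : G → ℂ} (hf : Continuous f)
    (h0 : ∀ᶠ y in 𝓝 e, f y = 0) :
    Tendsto (fun n => ∑ k, ∫ y, f y ∂(ν n k)) atTop (𝓝 (∫ y, f y ∂η)) := by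
  have hre := h _ (Complex.continuous_re.comp hf) (h0.mono fun y hy => by simp [hy])
  have him := h _ (Complex.continuous_im.comp hf) (h0.mono fun y hy => by simp [hy])
  have key : ∀ μ : Measure G, Integrable f μ → ∫ y, f y ∂μ =
      ((∫ y, (Complex.re ∘ f) y ∂μ : ℝ) : ℂ) + ((∫ y, (Complex.im ∘ f) y ∂μ : ℝ) : ℂ) *
        Complex.I := fun μ hμ => (integral_re_add_im hμ).symm
  rw [key η (hη.integrable hf h0)]
  simp only [fun n k => key (ν n k) (hf.integrable_of_compactSpace _), Finset.sum_add_distrib,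
    ← Finset.sum_mul, ← Complex.ofReal_sum]
  exact ((Complex.continuous_ofReal.tendsto _).comp hre).add
    (((Complex.continuous_ofReal.tendsto _).comp him).mul_const _)

/-- The function is small near e and bounded by compactness, while little mass lies elsewhere,
uniformly along the row. -/
theorem IsNullArray.eventually_integral_le [∀ n k, IsProbabilityMeasure (ν n k)]
    (h : IsNullArray e ν) {w : G → ℝ} (hw : Continuous w) (hwe : w e = 0) {ε : ℝ} (hε : 0 < ε) :
    ∀ᶠ n in atTop, ∀ k, ∫ y, w y ∂(ν n k) ≤ ε := by
  obtain ⟨M, hM⟩ := isCompact_univ.exists_bound_of_continuousOn hw.continuousOn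
  have hMe : 0 ≤ M := (norm_nonneg _).trans (hM e (Set.mem_univ e))
  have hUo : IsOpen {y | w y < ε / 2} := isOpen_lt hw continuous_const
  have hUe : {y | w y < ε / 2} ∈ 𝓝 e := hUo.mem_nhds (by simp [hwe, hε])
  filter_upwards [h _ hUe (ε / 2 / (M + 1)) (by positivity)] with n hn k
  have hle : ∀ y, w y ≤ ε / 2 + {y | w y < ε / 2}ᶜ.indicator (fun _ => M) y := by
    intro y
    by_cases hy : w y < ε / 2
    · simp [hy, hy.le]
    · rw [Set.indicator_of_mem (by simpa using hy)]
      linarith [(le_abs_self _).trans (hM y (Set.mem_univ y))]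
  have hi : Integrable ({y | w y < ε / 2}ᶜ.indicator fun _ => M) (ν n k) :=
    (integrable_const M).indicator hUo.measurableSet.compl
  calc ∫ y, w y ∂(ν n k)
      ≤ ∫ y, (ε / 2 + {y | w y < ε / 2}ᶜ.indicator (fun _ => M) y) ∂(ν n k) :=
        integral_mono (hw.integrable_of_compactSpace _) ((integrable_const _).add hi) hle
    _ = ε / 2 + (ν n k).real {y | w y < ε / 2}ᶜ * M := by
        rw [integral_add (integrable_const _) hi, integral_indicator_const _
          hUo.measurableSet.compl]
        simp
    _ ≤ ε / 2 + ε / 2 / (M + 1) * (M + 1) := by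
        gcongr
        · exact hn k
        · linarith
    _ = ε := by field_simp; ring

/-- Integrands depending on n and k may be replaced by a fixed one: the total error is at most max δ
times the row sum of ∫w, which converges because w vanishes near e. -/
theorem TendstoAwayFrom.tendsto_of_norm_sub_le [∀ n k, IsProbabilityMeasure (ν n k)]
    (h : TendstoAwayFrom e ν η) (hη : IsFiniteAwayFrom e η)
    {F : ∀ n, Fin (K n) → G → ℂ} {f : G → ℂ} {w : G → ℝ} {δ : ∀ n, Fin (K n) → ℝ}
    (hF : ∀ n k, Continuous (F n k)) (hf : Continuous f) (hw : Continuous w)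
    (hf0 : ∀ᶠ y in 𝓝 e, f y = 0) (hw0 : ∀ᶠ y in 𝓝 e, w y = 0) (hwn : ∀ y, 0 ≤ w y)
    (hle : ∀ n k y, ‖F n k y - f y‖ ≤ δ n k * w y)
    (hδ : ∀ ε > 0, ∀ᶠ n in atTop, ∀ k, δ n k ≤ ε) :
    Tendsto (fun n => ∑ k, ∫ y, F n k y ∂(ν n k)) atTop (𝓝 (∫ y, f y ∂η)) := by
  have h1 := h.tendsto_complex hη hf hf0
  have h2 := h w hw hw0
  set W := ∫ y, w y ∂η
  have hW : 0 ≤ W := integral_nonneg hwn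
  have h3 : Tendsto (fun n => ∑ k, ∫ y, F n k y ∂(ν n k) - ∑ k, ∫ y, f y ∂(ν n k)) atTop
      (𝓝 0) := by
    rw [Metric.tendsto_nhds]
    intro ε hε
    filter_upwards [hδ (ε / 2 / (W + 1)) (by positivity),
      h2.eventually (eventually_le_nhds (lt_add_one W))] with n hn1 hn2
    rw [dist_zero_right, ← Finset.sum_sub_distrib]
    calc _ ≤ ∑ k, ‖∫ y, F n k y ∂(ν n k) - ∫ y, f y ∂(ν n k)‖ := norm_sum_le _ _
      _ ≤ ∑ k, ε / 2 / (W + 1) * ∫ y, w y ∂(ν n k) := by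
          refine Finset.sum_le_sum fun k _ => ?_
          rw [← integral_sub ((hF n k).integrable_of_compactSpace _)
            (hf.integrable_of_compactSpace _), ← integral_const_mul]
          refine norm_integral_le_of_norm_le ((hw.integrable_of_compactSpace _).const_mul _)
            (Eventually.of_forall fun y => (hle n k y).trans ?_)
          exact mul_le_mul_of_nonneg_right (hn1 k) (hwn y)
      _ = ε / 2 / (W + 1) * ∑ k, ∫ y, w y ∂(ν n k) := by rw [Finset.mul_sum]
      _ ≤ ε / 2 / (W + 1) * (W + 1) := by gcongr
      _ < ε := by rw [div_mul_cancel₀ _ (by positivity)]; linarith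
  simpa using h3.add h1

end MeasureArrays

/-! ### A continuous cut-off -/

section CutOff

/-- A continuous cut-off, zero for `|x| ≤ τ / 2` and one for `|x| ≥ τ`. -/
noncomputable def cutOff (τ x : ℝ) : ℝ := min 1 (max 0 (2 * |x| / τ - 1))

theorem continuous_cutOff (τ : ℝ) : Continuous (cutOff τ) := by
  unfold cutOff; fun_prop

theorem cutOff_nonneg (τ x : ℝ) : 0 ≤ cutOff τ x := le_min zero_le_one (le_max_left _ _)

theorem cutOff_le_one (τ x : ℝ) : cutOff τ x ≤ 1 := min_le_left _ _

theorem cutOff_eq_zero {τ x : ℝ} (hτ : 0 < τ) (hx : |x| ≤ τ / 2) : cutOff τ x = 0 := by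
  have h : 2 * |x| / τ - 1 ≤ 0 := by
    rw [sub_nonpos, div_le_one hτ]; linarith
  rw [cutOff, max_eq_left h, min_eq_right zero_le_one]

theorem cutOff_eq_one {τ x : ℝ} (hτ : 0 < τ) (hx : τ ≤ |x|) : cutOff τ x = 1 := by
  have h : 1 ≤ 2 * |x| / τ - 1 := by
    rw [le_sub_iff_add_le, le_div_iff₀ hτ]; linarith
  rw [cutOff, min_eq_left (h.trans (le_max_right _ _))]

end CutOff

/-! ### The limit of centred row products -/

section ArrayLimit

variable {G : Type*} [TopologicalSpace G] [MeasurableSpace G] [CompactSpace G] [BorelSpace G]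
  {K : ℕ → ℕ} {e : G} {ν : ∀ n, Fin (K n) → Measure G} {η : Measure G}

/-- As Y is bounded, the cubic estimate is at most a constant times Y², which is integrable even
when η is infinite. -/
theorem integrable_expRemainder {Y : G → ℝ} (hY : Continuous Y)
    (hY2 : Integrable (fun y => Y y ^ 2) η) (c : ℝ) :
    Integrable (fun y => expRemainder c (Y y)) η := by
  obtain ⟨M, hM⟩ := isCompact_univ.exists_bound_of_continuousOn hY.continuousOn
  refine (hY2.const_mul (|c| ^ 3 * Real.exp (|c| * M) * M)).mono'
    ((continuous_expRemainder c).comp hY).aestronglyMeasurable (Eventually.of_forall fun y => ?_)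
  have hy : |Y y| ≤ M := hM y (Set.mem_univ y)
  refine (norm_expRemainder_le_cube hy).trans ?_
  rw [pow_succ' |Y y| 2, sq_abs, mul_assoc _ M]
  gcongr

variable [∀ n k, IsProbabilityMeasure (ν n k)]

theorem IsNullArray.eventually_abs_integral_le (h : IsNullArray e ν) {Y : G → ℝ}
    (hY : Continuous Y) (hYe : Y e = 0) :
    ∀ ε > 0, ∀ᶠ n in atTop, ∀ k, |∫ y, Y y ∂(ν n k)| ≤ ε := fun ε hε => by
  filter_upwards [h.eventually_integral_le hY.abs (by simp [hYe]) hε] with n hn k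
  exact abs_integral_le_integral_abs.trans (hn k)

/-- The cut-off κ splits the remainder. The part with κ vanishes near e, so convergence away from e
applies once the vanishing means are dropped. The part with 1 - κ lives on |Y| < τ and is at most
2Dτ(Y - m)², hence of order τ times the sum of variances. -/
theorem tendsto_sum_integral_expRemainder (hnull : IsNullArray e ν) (hη : IsFiniteAwayFrom e η)
    (htend : TendstoAwayFrom e ν η) {Y : G → ℝ} (hY : Continuous Y) (hYe : Y e = 0)
    (hY2 : Integrable (fun y => Y y ^ 2) η) {V : ℝ}
    (hvar : Tendsto (fun n => ∑ k, Var[Y; ν n k]) atTop (𝓝 V)) (c : ℝ) :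
    Tendsto (fun n => ∑ k, ∫ y, expRemainder c (Y y - ∫ z, Y z ∂(ν n k)) ∂(ν n k)) atTop
      (𝓝 (∫ y, expRemainder c (Y y) ∂η)) := by
  obtain ⟨M, hM⟩ := isCompact_univ.exists_bound_of_continuousOn hY.continuousOn
  replace hM : ∀ y, |Y y| ≤ M := fun y => hM y (Set.mem_univ y)
  have hM0 : 0 ≤ M := (abs_nonneg _).trans (hM e)
  set m : ∀ n, Fin (K n) → ℝ := fun n k => ∫ z, Y z ∂(ν n k) with hm
  have hmM : ∀ n k, |m n k| ≤ M := fun n k => by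
    have := norm_integral_le_of_norm_le_const (μ := ν n k) (f := Y) (C := M)
      (Eventually.of_forall hM)
    simpa using this
  have hsub : ∀ n k y, |Y y - m n k| ≤ 2 * M := fun n k y =>
    (abs_sub _ _).trans (by linarith [hM y, hmM n k])
  have hV : 0 ≤ V := ge_of_tendsto' hvar fun n => Finset.sum_nonneg fun k _ => variance_nonneg _ _
  set J := ∫ y, Y y ^ 2 ∂η
  have hJ : 0 ≤ J := integral_nonneg fun y => sq_nonneg _
  set D := |c| ^ 3 * Real.exp (|c| * (2 * M))
  have hD : 0 ≤ D := by positivity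
  have hmnull := hnull.eventually_abs_integral_le hY hYe
  have hRc : ∀ a : ℝ, Continuous fun y => expRemainder c (Y y - a) := fun a =>
    (continuous_expRemainder c).comp (hY.sub continuous_const)
  rw [Metric.tendsto_nhds]
  intro ε hε
  -- Chosen so that the near parts of the row sum (variances eventually at most V + 1) and of the
  -- limit (second moment J) together cost at most ε/4.
  set τ := ε / 4 / (2 * D * (V + 1) + 2 * D * J + 1) with hτ
  have hden : 0 < 2 * D * (V + 1) + 2 * D * J + 1 := by positivity
  have hτ0 : 0 < τ := by positivity
  have hτε : τ * (2 * D) * (V + 1) + τ * (2 * D) * J ≤ ε / 4 := by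
    have : τ * (2 * D * (V + 1) + 2 * D * J + 1) = ε / 4 := div_mul_cancel₀ _ hden.ne'
    nlinarith
  set κ : G → ℝ := fun y => cutOff τ (Y y) with hκ
  have hκc : Continuous κ := (continuous_cutOff τ).comp hY
  have hκ0 : ∀ᶠ y in 𝓝 e, κ y = 0 := by
    have h1 : ∀ᶠ y in 𝓝 e, |Y y| < τ / 2 :=
      hY.abs.continuousAt.eventually_lt continuousAt_const (by simpa [hYe] using hτ0)
    exact h1.mono fun y hy => cutOff_eq_zero hτ0 hy.le
  have hfar : Tendsto (fun n => ∑ k, ∫ y, (κ y : ℂ) * expRemainder c (Y y - m n k) ∂(ν n k)) atTop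
      (𝓝 (∫ y, (κ y : ℂ) * expRemainder c (Y y) ∂η)) := by
    refine htend.tendsto_of_norm_sub_le hη (w := κ)
      (δ := fun n k => (2 * |c| + c ^ 2 * (2 * M)) * |m n k|)
      (fun n k => (Complex.continuous_ofReal.comp hκc).mul (hRc _))
      ((Complex.continuous_ofReal.comp hκc).mul ((continuous_expRemainder c).comp hY)) hκc
      (hκ0.mono fun y hy => by simp [hy]) hκ0 (fun y => cutOff_nonneg _ _) (fun n k y => ?_) ?_
    · rw [← mul_sub, norm_mul, Complex.norm_real, Real.norm_of_nonneg (cutOff_nonneg _ _), mul_comm]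
      refine mul_le_mul_of_nonneg_right ?_ (cutOff_nonneg _ _)
      have := norm_expRemainder_sub_le (c := c) (hsub n k y) ((hM y).trans (by linarith))
      rwa [sub_sub_cancel_left, abs_neg] at this
    · intro ε' hε'
      have hL : 0 < 2 * |c| + c ^ 2 * (2 * M) + 1 := by positivity
      filter_upwards [hmnull (ε' / (2 * |c| + c ^ 2 * (2 * M) + 1)) (by positivity)] with n hn k
      calc _ ≤ (2 * |c| + c ^ 2 * (2 * M) + 1) * (ε' / (2 * |c| + c ^ 2 * (2 * M) + 1)) := by
            refine mul_le_mul (by linarith) (hn k) (abs_nonneg _) hL.le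
        _ = ε' := mul_div_cancel₀ _ hL.ne'
  have hnear : ∀ y a, |a| ≤ τ → |Y y - a| ≤ 2 * M →
      ‖((1 - κ y : ℝ) : ℂ) * expRemainder c (Y y - a)‖ ≤ τ * (2 * D) * (Y y - a) ^ 2 := by
    intro y a ha haM
    by_cases hy : τ ≤ |Y y|
    · rw [hκ]
      simp only [cutOff_eq_one hτ0 hy, sub_self, Complex.ofReal_zero, zero_mul, norm_zero]
      positivity
    · have h1 : |Y y - a| ≤ 2 * τ := (abs_sub _ _).trans (by linarith)
      rw [norm_mul, Complex.norm_real,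
        Real.norm_of_nonneg (sub_nonneg.mpr (cutOff_le_one _ _))]
      calc (1 - κ y) * ‖expRemainder c (Y y - a)‖ ≤ 1 * (D * |Y y - a| ^ 3) := by
            gcongr
            · exact sub_le_self _ (cutOff_nonneg _ _)
            · exact norm_expRemainder_le_cube haM
        _ = D * (|Y y - a| * (Y y - a) ^ 2) := by rw [pow_succ', sq_abs, one_mul]
        _ ≤ D * (2 * τ * (Y y - a) ^ 2) := by gcongr
        _ = _ := by ring
  have hlim : ‖∫ y, ((1 - κ y : ℝ) : ℂ) * expRemainder c (Y y) ∂η‖ ≤ τ * (2 * D) * J := by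
    rw [← integral_const_mul]
    refine norm_integral_le_of_norm_le (hY2.const_mul _) (Eventually.of_forall fun y => ?_)
    -- The limit integrand is uncentred, so the near estimate is used with a = 0.
    have := hnear y 0 (by simpa using hτ0.le) (by simpa using (hM y).trans (by linarith))
    simpa using this
  filter_upwards [hmnull τ hτ0, hvar.eventually (eventually_le_nhds (lt_add_one V)),
    (Metric.tendsto_nhds.mp hfar) (ε / 4) (by positivity)] with n hn1 hn2 hn3
  have hsplit : ∀ (μ : Measure G) (a : ℝ), Integrable (fun y => expRemainder c (Y y - a)) μ →
      ∫ y, expRemainder c (Y y - a) ∂μ = ∫ y, (κ y : ℂ) * expRemainder c (Y y - a) ∂μ +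
        ∫ y, ((1 - κ y : ℝ) : ℂ) * expRemainder c (Y y - a) ∂μ := by
    intro μ a hi
    have h1 : Integrable (fun y => (κ y : ℂ) * expRemainder c (Y y - a)) μ :=
      hi.bdd_mul (c := 1) (Complex.continuous_ofReal.comp hκc).aestronglyMeasurable
        (Eventually.of_forall fun y => by
          rw [Complex.norm_real, Real.norm_of_nonneg (cutOff_nonneg _ _)]
          exact cutOff_le_one _ _)
    have h2 : (fun y => ((1 - κ y : ℝ) : ℂ) * expRemainder c (Y y - a)) =
        fun y => expRemainder c (Y y - a) - (κ y : ℂ) * expRemainder c (Y y - a) := by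
      funext y; push_cast; ring
    rw [h2, integral_sub hi h1]
    ring
  have hrow : ‖∑ k, ∫ y, ((1 - κ y : ℝ) : ℂ) * expRemainder c (Y y - m n k) ∂(ν n k)‖ ≤
      τ * (2 * D) * (V + 1) := by
    calc _ ≤ ∑ k, ‖∫ y, ((1 - κ y : ℝ) : ℂ) * expRemainder c (Y y - m n k) ∂(ν n k)‖ :=
          norm_sum_le _ _
      _ ≤ ∑ k, τ * (2 * D) * Var[Y; ν n k] := by
          refine Finset.sum_le_sum fun k _ => ?_
          rw [variance_eq_integral hY.measurable.aemeasurable, ← integral_const_mul]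
          exact norm_integral_le_of_norm_le
            ((((hY.sub continuous_const).pow 2).integrable_of_compactSpace _).const_mul _)
            (Eventually.of_forall fun y => hnear y _ (hn1 k) (hsub n k y))
      _ = τ * (2 * D) * ∑ k, Var[Y; ν n k] := by rw [Finset.mul_sum]
      _ ≤ _ := by gcongr
  have hη' := hsplit η 0 (by simpa using integrable_expRemainder hY hY2 c)
  simp only [sub_zero] at hη'
  rw [hη', Finset.sum_congr rfl fun k _ =>
    hsplit (ν n k) (m n k) ((hRc _).integrable_of_compactSpace _), Finset.sum_add_distrib]
  refine (dist_add_add_le _ _ _ _).trans_lt ?_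
  have := dist_le_norm_add_norm
    (∑ k, ∫ y, ((1 - κ y : ℝ) : ℂ) * expRemainder c (Y y - m n k) ∂(ν n k))
    (∫ y, ((1 - κ y : ℝ) : ℂ) * expRemainder c (Y y) ∂η)
  linarith

theorem integrable_sub_exp {χ : G → ℂ} {Y : G → ℝ} {c : ℝ} (hη : IsFiniteAwayFrom e η)
    (hχc : Continuous χ) (hY : Continuous Y)
    (hχ : ∀ᶠ y in 𝓝 e, χ y = Complex.exp (Complex.I * ((c * Y y : ℝ) : ℂ))) :
    Integrable (fun y => χ y - Complex.exp (Complex.I * ((c * Y y : ℝ) : ℂ))) η :=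
  hη.integrable (by fun_prop) (hχ.mono fun y hy => by rw [hy, sub_self])

/-- With z = χ(y) and x = Y(y), each of the three terms is η-integrable for its own reason:
vanishing near e, the cubic bound, and square integrability of Y. -/
theorem sub_one_sub_eq_add_expRemainder (z : ℂ) (c x : ℝ) :
    z - 1 - Complex.I * ((c * x : ℝ) : ℂ) =
      (z - Complex.exp (Complex.I * ((c * x : ℝ) : ℂ))) + expRemainder c x -
        ((c ^ 2 / 2 * x ^ 2 : ℝ) : ℂ) := by
  rw [expRemainder]; push_cast; ring

/-- The integrand of the exponent of a generalized Poisson measure is integrable. -/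
theorem integrable_sub_one_sub {χ : G → ℂ} {Y : G → ℝ} {c : ℝ} (hη : IsFiniteAwayFrom e η)
    (hχc : Continuous χ) (hY : Continuous Y) (hY2 : Integrable (fun y => Y y ^ 2) η)
    (hχ : ∀ᶠ y in 𝓝 e, χ y = Complex.exp (Complex.I * ((c * Y y : ℝ) : ℂ))) :
    Integrable (fun y => χ y - 1 - Complex.I * ((c * Y y : ℝ) : ℂ)) η := by
  simp only [sub_one_sub_eq_add_expRemainder]
  exact ((integrable_sub_exp hη hχc hY hχ).add (integrable_expRemainder hY hY2 c)).sub
    (hY2.const_mul _).ofReal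

theorem integral_sub_one_sub {χ : G → ℂ} {Y : G → ℝ} {c : ℝ} (hη : IsFiniteAwayFrom e η)
    (hχc : Continuous χ) (hY : Continuous Y) (hY2 : Integrable (fun y => Y y ^ 2) η)
    (hχ : ∀ᶠ y in 𝓝 e, χ y = Complex.exp (Complex.I * ((c * Y y : ℝ) : ℂ))) :
    ∫ y, (χ y - 1 - Complex.I * ((c * Y y : ℝ) : ℂ)) ∂η =
      ∫ y, (χ y - Complex.exp (Complex.I * ((c * Y y : ℝ) : ℂ))) ∂η +
        ∫ y, expRemainder c (Y y) ∂η - ((c ^ 2 / 2 * ∫ y, Y y ^ 2 ∂η : ℝ) : ℂ) := by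
  simp only [sub_one_sub_eq_add_expRemainder]
  have h1 := integrable_sub_exp hη hχc hY hχ
  have h2 := integrable_expRemainder hY hY2 c
  have h3 : Integrable (fun y => ((c ^ 2 / 2 * Y y ^ 2 : ℝ) : ℂ)) η := (hY2.const_mul _).ofReal
  rw [integral_sub (h1.fun_add h2) h3, integral_add h1 h2,
    integral_complex_ofReal, integral_const_mul]

/-- The deviation from one of a centred characteristic function. -/
theorem centred_integral_sub_one_eq (μ : Measure G) [IsProbabilityMeasure μ] {χ : G → ℂ}
    {Y : G → ℝ} (hχc : Continuous χ) (hY : Continuous Y) (c : ℝ) :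
    Complex.exp (-(Complex.I * ((c * ∫ z, Y z ∂μ : ℝ) : ℂ))) * ∫ y, χ y ∂μ - 1 =
      ∫ y, Complex.exp (-(Complex.I * ((c * ∫ z, Y z ∂μ : ℝ) : ℂ))) *
        (χ y - Complex.exp (Complex.I * ((c * Y y : ℝ) : ℂ))) ∂μ +
      ∫ y, expRemainder c (Y y - ∫ z, Y z ∂μ) ∂μ - ((c ^ 2 / 2 * Var[Y; μ] : ℝ) : ℂ) := by
  set m := ∫ z, Y z ∂μ with hm
  -- The last, linear term integrates to zero by the choice of m as the mean; this is the purpose of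
  -- centring.
  have hpt : ∀ y, Complex.exp (-(Complex.I * ((c * m : ℝ) : ℂ))) * χ y - 1 =
      Complex.exp (-(Complex.I * ((c * m : ℝ) : ℂ))) *
        (χ y - Complex.exp (Complex.I * ((c * Y y : ℝ) : ℂ))) + expRemainder c (Y y - m) -
      ((c ^ 2 / 2 * (Y y - m) ^ 2 : ℝ) : ℂ) + Complex.I * ((c * (Y y - m) : ℝ) : ℂ) := by
    intro y
    have h1 : Complex.exp (Complex.I * ((c * (Y y - m) : ℝ) : ℂ)) =
        Complex.exp (-(Complex.I * ((c * m : ℝ) : ℂ))) *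
          Complex.exp (Complex.I * ((c * Y y : ℝ) : ℂ)) := by
      rw [← Complex.exp_add]; congr 1; push_cast; ring
    rw [expRemainder, h1]
    push_cast
    ring
  have hR : Continuous fun y => expRemainder c (Y y - m) :=
    (continuous_expRemainder c).comp (hY.sub continuous_const)
  have hf : Continuous fun y => Complex.exp (-(Complex.I * ((c * m : ℝ) : ℂ))) *
        (χ y - Complex.exp (Complex.I * ((c * Y y : ℝ) : ℂ))) := by fun_prop
  have hq : Continuous fun y => ((c ^ 2 / 2 * (Y y - m) ^ 2 : ℝ) : ℂ) := by fun_prop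
  have hl : Continuous fun y => Complex.I * ((c * (Y y - m) : ℝ) : ℂ) := by fun_prop
  have h0 : ∫ y, Complex.I * ((c * (Y y - m) : ℝ) : ℂ) ∂μ = 0 := by
    rw [integral_const_mul, integral_complex_ofReal, integral_const_mul,
      integral_sub (hY.integrable_of_compactSpace μ) (integrable_const m)]
    simp [hm]
  have hL : Complex.exp (-(Complex.I * ((c * m : ℝ) : ℂ))) * ∫ y, χ y ∂μ - 1 =
      ∫ y, (Complex.exp (-(Complex.I * ((c * m : ℝ) : ℂ))) * χ y - 1) ∂μ := by
    rw [integral_sub ((hχc.integrable_of_compactSpace μ).const_mul _) (integrable_const _),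
      integral_const_mul]
    simp
  rw [hL, integral_congr_ae (Eventually.of_forall hpt),
    integral_add (((hf.fun_add hR).fun_sub hq).integrable_of_compactSpace μ)
      (hl.integrable_of_compactSpace μ), h0, add_zero,
    integral_sub ((hf.fun_add hR).integrable_of_compactSpace μ) (hq.integrable_of_compactSpace μ),
    integral_add (hf.integrable_of_compactSpace μ) (hR.integrable_of_compactSpace μ),
    integral_complex_ofReal, integral_const_mul (c ^ 2 / 2),
    variance_eq_integral hY.measurable.aemeasurable]

theorem norm_exp_neg_I_mul (x : ℝ) : ‖Complex.exp (-(Complex.I * (x : ℂ)))‖ = 1 := by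
  rw [show -(Complex.I * (x : ℂ)) = ((-x : ℝ) : ℂ) * Complex.I by push_cast; ring,
    Complex.norm_exp_ofReal_mul_I]

/-- Supplies both inputs of the product lemma: the right side is uniformly small along a null array,
and its row sums stay bounded. -/
theorem norm_centred_integral_sub_one_le (μ : Measure G) [IsProbabilityMeasure μ] {χ : G → ℂ}
    {Y : G → ℝ} (hχc : Continuous χ) (hY : Continuous Y) (c : ℝ) {M : ℝ} (hM : ∀ y, |Y y| ≤ M) :
    ‖Complex.exp (-(Complex.I * ((c * ∫ z, Y z ∂μ : ℝ) : ℂ))) * ∫ y, χ y ∂μ - 1‖ ≤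
      ∫ y, ‖χ y - Complex.exp (Complex.I * ((c * Y y : ℝ) : ℂ))‖ ∂μ +
        (|c| ^ 3 * Real.exp (|c| * (2 * M)) * (2 * M) + c ^ 2 / 2) * Var[Y; μ] := by
  rw [centred_integral_sub_one_eq μ hχc hY c]
  set m := ∫ z, Y z ∂μ with hm
  have hmM : |m| ≤ M := by
    have := norm_integral_le_of_norm_le_const (μ := μ) (f := Y) (C := M)
      (Eventually.of_forall hM)
    simpa using this
  have hsub : ∀ y, |Y y - m| ≤ 2 * M := fun y =>
    (abs_sub _ _).trans (by linarith [hM y, hmM])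
  have h1 : ‖∫ y, Complex.exp (-(Complex.I * ((c * m : ℝ) : ℂ))) *
      (χ y - Complex.exp (Complex.I * ((c * Y y : ℝ) : ℂ))) ∂μ‖ ≤
      ∫ y, ‖χ y - Complex.exp (Complex.I * ((c * Y y : ℝ) : ℂ))‖ ∂μ := by
    rw [integral_const_mul, norm_mul, norm_exp_neg_I_mul, one_mul]
    exact norm_integral_le_integral_norm _
  have h2 : ‖∫ y, expRemainder c (Y y - m) ∂μ‖ ≤
      |c| ^ 3 * Real.exp (|c| * (2 * M)) * (2 * M) * Var[Y; μ] := by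
    rw [variance_eq_integral hY.measurable.aemeasurable, ← integral_const_mul]
    refine norm_integral_le_of_norm_le
      ((((hY.sub continuous_const).pow 2).integrable_of_compactSpace _).const_mul _)
      (Eventually.of_forall fun y => (norm_expRemainder_le_cube (hsub y)).trans ?_)
    rw [pow_succ' |Y y - m| 2, sq_abs, mul_assoc _ (2 * M)]
    gcongr
    exact hsub y
  have h3 : ‖((c ^ 2 / 2 * Var[Y; μ] : ℝ) : ℂ)‖ = c ^ 2 / 2 * Var[Y; μ] := by
    rw [Complex.norm_real, Real.norm_of_nonneg
      (mul_nonneg (by positivity) (variance_nonneg _ _))]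
  refine (norm_sub_le _ _).trans ((add_le_add ((norm_add_le _ _).trans
    (add_le_add h1 h2)) h3.le).trans (le_of_eq (by ring)))

/-- The limit of the centred row products of the characteristic functions of a null array. -/
theorem tendsto_prod_centred_integral (hnull : IsNullArray e ν) (hη : IsFiniteAwayFrom e η)
    (htend : TendstoAwayFrom e ν η) {Y : G → ℝ} (hY : Continuous Y) (hYe : Y e = 0)
    (hY2 : Integrable (fun y => Y y ^ 2) η) {b : ℝ}
    (hvar : Tendsto (fun n => ∑ k, Var[Y; ν n k]) atTop (𝓝 (b + ∫ y, Y y ^ 2 ∂η)))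
    {χ : G → ℂ} (hχc : Continuous χ) (hχ1 : ∀ y, ‖χ y‖ = 1) {c : ℝ}
    (hχ : ∀ᶠ y in 𝓝 e, χ y = Complex.exp (Complex.I * ((c * Y y : ℝ) : ℂ))) :
    Tendsto (fun n => ∏ k, (Complex.exp (-(Complex.I * ((c * ∫ y, Y y ∂(ν n k) : ℝ) : ℂ))) *
      ∫ y, χ y ∂(ν n k))) atTop
      (𝓝 (Complex.exp (-((c ^ 2 / 2 * b : ℝ) : ℂ) +
        ∫ y, (χ y - 1 - Complex.I * ((c * Y y : ℝ) : ℂ)) ∂η))) := by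
  obtain ⟨M, hM⟩ := isCompact_univ.exists_bound_of_continuousOn hY.continuousOn
  replace hM : ∀ y, |Y y| ≤ M := fun y => hM y (Set.mem_univ y)
  have hM0 : 0 ≤ M := (abs_nonneg _).trans (hM e)
  set V := b + ∫ y, Y y ^ 2 ∂η with hV
  set D := |c| ^ 3 * Real.exp (|c| * (2 * M)) * (2 * M) + c ^ 2 / 2 with hD
  have hD0 : 0 ≤ D := by positivity
  set f : G → ℂ := fun y => χ y - Complex.exp (Complex.I * ((c * Y y : ℝ) : ℂ)) with hf
  have hfc : Continuous f := by fun_prop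
  have hf0 : ∀ᶠ y in 𝓝 e, f y = 0 := hχ.mono fun y hy => by simp only [hf, hy, sub_self]
  have hfe : ‖f e‖ = 0 := by rw [hf0.self_of_nhds, norm_zero]
  have hnf := htend (fun y => ‖f y‖) hfc.norm (hf0.mono fun y hy => by simp [hy])
  have hbound : ∀ n k, ‖Complex.exp (-(Complex.I * ((c * ∫ y, Y y ∂(ν n k) : ℝ) : ℂ))) *
      ∫ y, χ y ∂(ν n k) - 1‖ ≤ ∫ y, ‖f y‖ ∂(ν n k) + D * Var[Y; ν n k] := fun n k =>
    norm_centred_integral_sub_one_le (ν n k) hχc hY c hM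
  refine tendsto_prod_of_tendsto_sum_sub_one (C := ∫ y, ‖f y‖ ∂η + 1 + D * (V + 1)) ?_ ?_ ?_ ?_
  · intro n k
    rw [norm_mul, norm_exp_neg_I_mul, one_mul]
    have := norm_integral_le_of_norm_le_const (μ := ν n k) (f := χ) (C := 1)
      (Eventually.of_forall fun y => (hχ1 y).le)
    simpa using this
  · intro ε hε
    filter_upwards [hnull.eventually_integral_le hfc.norm hfe (ε := ε / 2) (by positivity),
      hnull.eventually_integral_le (w := fun y => Y y ^ 2) (hY.pow 2) (by simp [hYe])
        (ε := ε / 2 / (D + 1)) (by positivity)] with n hn1 hn2 k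
    refine (hbound n k).trans ?_
    have hv : Var[Y; ν n k] ≤ ε / 2 / (D + 1) :=
      (variance_le_expectation_sq hY.aestronglyMeasurable).trans (hn2 k)
    calc _ ≤ ε / 2 + (D + 1) * (ε / 2 / (D + 1)) :=
          add_le_add (hn1 k) (mul_le_mul (by linarith) hv (variance_nonneg _ _) (by positivity))
      _ = ε := by rw [mul_div_cancel₀ _ (by positivity)]; ring
  · filter_upwards [hnf.eventually (eventually_le_nhds (lt_add_one _)),
      hvar.eventually (eventually_le_nhds (lt_add_one V))] with n hn1 hn2
    refine (Finset.sum_le_sum fun k _ => hbound n k).trans ?_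
    rw [Finset.sum_add_distrib, ← Finset.mul_sum]
    gcongr
  · simp only [centred_integral_sub_one_eq _ hχc hY c, Finset.sum_add_distrib,
      Finset.sum_sub_distrib, ← Complex.ofReal_sum, ← Finset.mul_sum]
    -- The ∫Y² dη contained in V is absorbed by the compensated integral, so only b remains in the
    -- Gauss term.
    have hlim : -((c ^ 2 / 2 * b : ℝ) : ℂ) +
        ∫ y, (χ y - 1 - Complex.I * ((c * Y y : ℝ) : ℂ)) ∂η =
        ∫ y, f y ∂η + ∫ y, expRemainder c (Y y) ∂η - ((c ^ 2 / 2 * V : ℝ) : ℂ) := by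
      rw [integral_sub_one_sub hη hχc hY hY2 hχ, hV, hf]
      push_cast
      ring
    rw [hlim]
    refine (Tendsto.add ?_ (tendsto_sum_integral_expRemainder hnull hη htend hY hYe hY2 hvar
      c)).sub ((Complex.continuous_ofReal.tendsto _).comp (hvar.const_mul _))
    -- The centring factor differs from 1 by at most |c||m|, uniformly small along the row.
    refine htend.tendsto_of_norm_sub_le hη (w := fun y => ‖f y‖)
      (δ := fun n k => |c| * |∫ y, Y y ∂(ν n k)|) (fun n k => by fun_prop) hfc hfc.norm hf0
      (hf0.mono fun y hy => by simp [hy]) (fun y => norm_nonneg _) (fun n k y => ?_) ?_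
    · rw [← sub_one_mul, norm_mul]
      refine mul_le_mul_of_nonneg_right ?_ (norm_nonneg _)
      have := norm_exp_I_mul_sub_exp_I_mul_le (-(c * ∫ y, Y y ∂(ν n k))) 0
      rwa [sub_zero, abs_neg, abs_mul, Complex.ofReal_zero, mul_zero, Complex.exp_zero,
        Complex.ofReal_neg, mul_neg] at this
    · intro ε hε
      filter_upwards [hnull.eventually_abs_integral_le hY hYe (ε / (|c| + 1)) (by positivity)]
        with n hn k
      calc _ ≤ (|c| + 1) * (ε / (|c| + 1)) :=
            mul_le_mul (by linarith) (hn k) (abs_nonneg _) (by positivity)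
        _ = ε := mul_div_cancel₀ _ (by positivity)

end ArrayLimit

/-! ### Infinitesimality and the generalized Poisson measure on the solenoid -/

section SolenoidLimit

variable (p : ℕ)

/-- Basic neighbourhoods of the neutral element of the solenoid in terms of arguments. -/
theorem exists_forall_abs_circleArg_le_imp_mem {U : Set (solenoid p)} (hU : U ∈ 𝓝 1) :
    ∃ (d : ℕ) (ε : ℝ), 0 < ε ∧
      ∀ y : solenoid p, (∀ j ≤ d, |circleArg ((y : ℕ → Circle) j)| ≤ ε) → y ∈ U := by
  rw [nhds_subtype_eq_comap, Filter.mem_comap] at hU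
  obtain ⟨W, hW, hWU⟩ := hU
  rw [nhds_pi, Filter.mem_pi] at hW
  obtain ⟨I, hI, t, ht, htW⟩ := hW
  obtain ⟨d, hd⟩ := hI.bddAbove
  have h1 : ∀ᶠ ε : ℝ in 𝓝[>] 0, ∀ j ∈ I, ∀ z : Circle, |circleArg z| ≤ ε → z ∈ t j := by
    refine (Filter.eventually_all_finite hI).mpr fun j _ => ?_
    have h2 : Circle.exp ⁻¹' t j ∈ 𝓝 (0 : ℝ) := by
      refine Circle.exp.continuous.continuousAt.preimage_mem_nhds ?_
      rw [Circle.exp_zero]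
      exact ht j
    obtain ⟨δ, hδ, hδt⟩ := Metric.mem_nhds_iff.mp h2
    filter_upwards [Ioo_mem_nhdsGT hδ] with ε hε z hz
    rw [← exp_circleArg z]
    exact hδt (by simpa using hz.trans_lt hε.2)
  obtain ⟨ε, hε, hε0⟩ := (h1.and self_mem_nhdsWithin).exists
  exact ⟨d, ε, hε0, fun y hy => hWU (htW fun j hj => hε j hj _ (hy j (hd hj)))⟩

theorem isInfinitesimalArray_of_tendsto_circleArg {Ω : ℕ → Type*} [∀ n, MeasurableSpace (Ω n)]
    {P : ∀ n, Measure (Ω n)} {K : ℕ → ℕ} {X : ∀ n, Fin (K n) → Ω n → solenoid p}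
    (h : ∀ (d : ℕ) (ε : ℝ), 0 < ε →
      Tendsto (fun n => ⨆ k : Fin (K n),
        P n {ω | ∃ j ≤ d, ε < |circleArg ((X n k ω : ℕ → Circle) j)|}) atTop (𝓝 0)) :
    IsInfinitesimalArray P K X := by
  intro U _ hU
  obtain ⟨d, ε, hε, hsub⟩ := exists_forall_abs_circleArg_le_imp_mem p hU
  refine tendsto_of_tendsto_of_tendsto_of_le_of_le tendsto_const_nhds (h d ε hε)
    (fun n => zero_le) fun n => iSup_mono fun k => measure_mono fun ω hω => ?_
  by_contra hcon
  simp only [Set.mem_ofPred_eq, not_exists, not_and, not_lt] at hcon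
  exact hω (hsub _ hcon)

theorem IsInfinitesimalArray.isNullArray {G : Type*} [CommGroup G] [TopologicalSpace G]
    [MeasurableSpace G] [OpensMeasurableSpace G] {Ω : ℕ → Type*} [∀ n, MeasurableSpace (Ω n)]
    {P : ∀ n, Measure (Ω n)} [∀ n, IsFiniteMeasure (P n)] {K : ℕ → ℕ}
    {X : ∀ n, Fin (K n) → Ω n → G} (h : IsInfinitesimalArray P K X)
    (hX : ∀ n k, Measurable (X n k)) :
    IsNullArray 1 (fun n k => (P n).map (X n k)) := by
  intro U hU ε hε
  -- U need not be Borel, so its interior is used instead.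
  have h1 := h (interior U) isOpen_interior.measurableSet (interior_mem_nhds.mpr hU)
  filter_upwards [h1.eventually (eventually_le_nhds (ENNReal.ofReal_pos.mpr hε))] with n hn k
  refine ENNReal.toReal_le_of_le_ofReal hε.le ((measure_mono (Set.compl_subset_compl.mpr
    interior_subset)).trans ?_)
  rw [Measure.map_apply (hX n k) isOpen_interior.measurableSet.compl]
  exact (le_iSup (fun k => P n {ω | X n k ω ∉ interior U}) k).trans hn

variable [hp : Fact p.Prime] {η : Measure (solenoid p)}

/-- Existence of the generalized Poisson measure on the solenoid. -/
theorem exists_isGeneralizedPoisson (hη : IsLevyMeasure η) :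
    ∃ π : ProbabilityMeasure (solenoid p), IsGeneralizedPoisson η (solenoidInner p) π := by
  obtain ⟨B, hB⟩ := (𝓝 (1 : solenoid p)).exists_antitone_basis
  set U : ℕ → Set (solenoid p) := fun n => interior (B n) with hU
  have hUo : ∀ n, IsOpen (U n) := fun n => isOpen_interior
  have hU1 : ∀ n, U n ∈ 𝓝 1 := fun n => interior_mem_nhds.mpr (hB.1.mem_of_mem trivial)
  have hUanti : Antitone U := fun i j hij => interior_mono (hB.2 hij)
  have hUnion : ⋃ n, (U n)ᶜ = {1}ᶜ := by
    rw [← Set.compl_iInter]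
    congr 1
    ext y
    simp only [Set.mem_iInter, Set.mem_singleton_iff]
    refine ⟨fun hy => ?_, fun hy n => hy ▸ mem_of_mem_nhds (hU1 n)⟩
    by_contra hne
    obtain ⟨n, -, hn⟩ := hB.1.mem_iff.mp (isOpen_compl_singleton.mem_nhds (Ne.symm hne))
    exact hn (interior_subset (hy n)) rfl
  have hfin : ∀ n, IsFiniteMeasure (η.restrict (U n)ᶜ) := fun n =>
    ⟨by simpa using hη.measure_compl_lt_top _ (hUo n).measurableSet (hU1 n)⟩
  -- Off U n the measure η is finite, so the compensated integral splits: a compound Poisson measure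
  -- shifted along the line by -∫ Y dη has the required transform.
  have happrox : ∀ n, ∃ ρ : ProbabilityMeasure (solenoid p), ∀ χ,
      fourierTransform (ρ : Measure (solenoid p)) χ = Complex.exp (∫ x in (U n)ᶜ,
        ((χ x : ℂ) - 1 - Complex.I * ((solenoidFreq p χ * truncArg p x : ℝ) : ℂ)) ∂η) := by
    intro n
    obtain ⟨ρ, hρ⟩ := exists_compoundPoisson (η.restrict (U n)ᶜ)
    obtain ⟨σ, hσ⟩ := exists_fourierTransform_eq_mul ρ
      ⟨Measure.dirac (solenoidLine p hp.out.ne_zero (-∫ x in (U n)ᶜ, truncArg p x ∂η)),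
        inferInstance⟩
    refine ⟨σ, fun χ => ?_⟩
    have hc : Continuous fun x => (χ x : ℂ) - 1 := (charBCF χ).continuous.sub continuous_const
    have hl : Continuous fun x : solenoid p =>
      Complex.I * ((solenoidFreq p χ * truncArg p x : ℝ) : ℂ) := by fun_prop
    rw [hσ, hρ, integral_sub (hc.integrable_of_compactSpace _) (hl.integrable_of_compactSpace _),
      integral_const_mul, integral_complex_ofReal, integral_const_mul]
    change _ * fourierTransform (Measure.dirac _) χ = _
    rw [fourierTransform_dirac_solenoidLine, ← Complex.exp_add]
    congr 1
    push_cast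
    ring
  choose ρ hρ using happrox
  refine exists_fourierTransform_eq_of_tendsto (μ := ρ) fun χ => ?_
  simp only [hρ]
  refine (Complex.continuous_exp.tendsto _).comp ?_
  have hint := integrable_sub_one_sub hη.measure_compl_lt_top (charBCF χ).continuous
    (truncArg p).continuous hη.integrable_truncArg_sq (eventually_char_eq_exp p χ)
  have hlim := tendsto_setIntegral_of_monotone (fun n => (hUo n).measurableSet.compl)
    (fun i j hij => Set.compl_subset_compl.mpr (hUanti hij)) hint.integrableOn
  -- The sets exhaust everything except e, which a Lévy measure does not charge.
  rw [hUnion, setIntegral_eq_integral_of_ae_compl_eq_zero] at hlim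
  · exact hlim
  · have h1 : ∀ᵐ y ∂η, y ∉ ({1} : Set (solenoid p)) :=
      measure_eq_zero_iff_ae_notMem.mp hη.measure_one
    filter_upwards [h1] with y hy hy'
    exact absurd hy hy'

end SolenoidLimit

/-! ### Independence and the limit theorem -/

theorem fourierTransform_map_prod {G : Type*} [CommGroup G] [TopologicalSpace G]
    [MeasurableSpace G] [BorelSpace G] [MeasurableMul₂ G] {Ω : Type*} [MeasurableSpace Ω]
    {P : Measure Ω} {ι : Type*} [Fintype ι] {X : ι → Ω → G} (hX : ∀ k, Measurable (X k))
    (hind : iIndepFun X P) (χ : PontryaginDual G) :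
    fourierTransform (P.map fun ω => ∏ k, X k ω) χ = ∏ k, fourierTransform (P.map (X k)) χ := by
  have hm : Measurable fun ω => ∏ k, X k ω := Finset.measurable_fun_prod _ fun k _ => hX k
  have hc : ∀ μ : Measure G, AEStronglyMeasurable (charBCF χ) μ := fun μ =>
    (charBCF χ).continuous.aestronglyMeasurable
  simp only [fourierTransform_eq_integral_charBCF]
  rw [integral_map hm.aemeasurable (hc _)]
  simp only [integral_map (hX _).aemeasurable (hc _)]
  rw [← hind.integral_fun_prod_comp (fun k => (hX k).aemeasurable) (fun k => hc _)]
  congr 1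
  funext ω
  simp only [charBCF_apply, map_prod]
  exact map_prod Circle.coeHom _ _

theorem mainTheorem10 (p : ℕ) [Fact p.Prime]
    {Ω : ℕ → Type*} [∀ n, MeasurableSpace (Ω n)]
    (P : ∀ n, Measure (Ω n)) [∀ n, IsProbabilityMeasure (P n)]
    (K : ℕ → ℕ) (X : ∀ n, Fin (K n) → Ω n → solenoid p)
    (hmeas : ∀ n k, Measurable (X n k))
    (hindep : ∀ n, iIndepFun (X n) (P n))
    (a : solenoid p) (b : ℝ) (hb : 0 ≤ b)
    (η : Measure (solenoid p)) (hη : IsLevyMeasure η)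
    (h_i : ∀ (d : ℕ) (ε : ℝ), 0 < ε →
      Tendsto (fun n => ⨆ k : Fin (K n),
        P n {ω | ∃ j ≤ d, ε < |circleArg ((X n k ω : ℕ → Circle) j)|}) atTop (𝓝 0))
    (h_ii : ∀ d : ℕ,
      Tendsto (fun n => Complex.exp (Complex.I / (p : ℂ) ^ d *
        ((∑ k : Fin (K n), ∫ ω, truncH (circleArg ((X n k ω : ℕ → Circle) 0)) ∂(P n) : ℝ) : ℂ)))
        atTop (𝓝 ((a : ℕ → Circle) d : ℂ)))
    (h_iii : Tendsto (fun n => ∑ k : Fin (K n),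
        variance (fun ω => truncH (circleArg ((X n k ω : ℕ → Circle) 0))) (P n)) atTop
      (𝓝 (b + ∫ y : solenoid p, truncH (circleArg ((y : ℕ → Circle) 0)) ^ 2 ∂η)))
    (h_iv : ∀ f : solenoid p →ᵇ ℝ, (∃ U ∈ 𝓝 (1 : solenoid p), ∀ y ∈ U, f y = 0) →
      Tendsto (fun n => ∑ k : Fin (K n), ∫ ω, f (X n k ω) ∂(P n)) atTop (𝓝 (∫ y, f y ∂η))) :
    IsInfinitesimalArray P K X ∧
      (∃! γ : ProbabilityMeasure (solenoid p), IsGaussMeasure (solenoidQuadraticForm p b) γ) ∧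
      (∃! π : ProbabilityMeasure (solenoid p), IsGeneralizedPoisson η (solenoidInner p) π) ∧
      ∀ γ π : ProbabilityMeasure (solenoid p),
        IsGaussMeasure (solenoidQuadraticForm p b) γ →
        IsGeneralizedPoisson η (solenoidInner p) π →
        TendstoInDistribution (fun n ω => ∏ k : Fin (K n), X n k ω) atTop id P
          (Measure.dirac a ∗ₘ (γ : Measure (solenoid p)) ∗ₘ (π : Measure (solenoid p))) := by
  have hinf := isInfinitesimalArray_of_tendsto_circleArg p h_i
  have hsep := exists_pontryaginDual_ne p
  obtain ⟨γ₀, hγ₀⟩ := exists_isGaussMeasure p hb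
  obtain ⟨π₀, hπ₀⟩ := exists_isGeneralizedPoisson p hη
  refine ⟨hinf, ⟨γ₀, hγ₀, fun γ hγ => eq_of_fourierTransform_eq hsep fun χ => by
    rw [hγ χ, hγ₀ χ]⟩, ⟨π₀, hπ₀, fun π hπ => eq_of_fourierTransform_eq hsep fun χ => by
    rw [hπ χ, hπ₀ χ]⟩, fun γ π hγ hπ => ?_⟩
  have hprod : ∀ n, Measurable fun ω => ∏ k : Fin (K n), X n k ω := fun n =>
    Finset.measurable_fun_prod _ fun k _ => hmeas n k
  refine ⟨fun n => (hprod n).aemeasurable, aemeasurable_id, ?_⟩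
  refine tendsto_of_tendsto_fourierTransform hsep fun χ => ?_
  simp only [ProbabilityMeasure.coe_mk, Measure.map_id, fourierTransform_map_prod (hmeas _)
    (hindep _), fourierTransform_mconv, fourierTransform_dirac, hγ χ, hπ χ]
  set ν : ∀ n, Fin (K n) → Measure (solenoid p) := fun n k => (P n).map (X n k) with hν
  have hνp : ∀ n k, IsProbabilityMeasure (ν n k) := fun n k =>
    Measure.isProbabilityMeasure_map (hmeas n k).aemeasurable
  have hmap : ∀ (f : solenoid p → ℝ), Continuous f → ∀ n k,
      ∫ y, f y ∂(ν n k) = ∫ ω, f (X n k ω) ∂(P n) := fun f hf n k =>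
    integral_map (hmeas n k).aemeasurable hf.aestronglyMeasurable
  have htend : TendstoAwayFrom 1 ν η := by
    intro f hf hf0
    simp only [hmap f hf]
    exact h_iv (BoundedContinuousFunction.mkOfCompact ⟨f, hf⟩) ⟨_, hf0, fun y hy => hy⟩
  have hvar : Tendsto (fun n => ∑ k, Var[truncArg p; ν n k]) atTop
      (𝓝 (b + ∫ y, truncArg p y ^ 2 ∂η)) := by
    simp only [hν, variance_map (truncArg p).continuous.measurable.aemeasurable
      (hmeas _ _).aemeasurable]
    exact h_iii
  set c := solenoidFreq p χ with hc
  have hlim := tendsto_prod_centred_integral (hinf.isNullArray hmeas) hη.measure_compl_lt_top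
    htend (truncArg p).continuous (truncArg_one p) hη.integrable_truncArg_sq hvar
    (charBCF χ).continuous (fun y => Circle.norm_coe _) (eventually_char_eq_exp p χ)
  have hdrift : Tendsto (fun n => Complex.exp (Complex.I *
      ((c * ∑ k, ∫ y, truncArg p y ∂(ν n k) : ℝ) : ℂ))) atTop (𝓝 (χ a : ℂ)) := by
    obtain ⟨d, l, rfl⟩ := exists_eq_solenoidChar p (Fact.out : p.Prime).ne_zero χ
    -- Condition (ii) is the case ℓ = 1; its ℓ-th power gives χ_{d,ℓ}, negative ℓ being allowed
    -- since the limit is nonzero.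
    have h1 := (h_ii d).zpow₀ l (Or.inl (Circle.coe_ne_zero _))
    rw [solenoidChar_apply, Circle.coe_zpow]
    refine h1.congr fun n => ?_
    rw [← Complex.exp_int_mul, hc, solenoidFreq_solenoidChar]
    simp only [hmap _ (truncArg p).continuous]
    congr 1
    simp only [truncArg_apply]
    push_cast
    ring
  have hfinal := hdrift.mul hlim
  convert hfinal using 2 with n
  -- The drift factor cancels the product of the centring factors, leaving the uncentred row
  -- product.
  · rw [Finset.prod_mul_distrib, ← Complex.exp_sum, ← mul_assoc, ← Complex.exp_add]
    have h0 : Complex.I * ((c * ∑ k, ∫ y, truncArg p y ∂(ν n k) : ℝ) : ℂ) +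
        ∑ k, -(Complex.I * ((c * ∫ y, truncArg p y ∂(ν n k) : ℝ) : ℂ)) = 0 := by
      rw [Finset.sum_neg_distrib, ← Finset.mul_sum, Finset.mul_sum, Complex.ofReal_sum]
      ring
    rw [h0, Complex.exp_zero, one_mul]
    rfl
  · congr 1
    rw [← Complex.exp_add]
    congr 2
    rw [solenoidQuadraticForm, ← hc]
    push_cast
    ring
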